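/- **Setting.** Let $n\ge 2$ be an integer, $\omega>0$, $Q:[0,2\pi]\to\mathbb R$. A network of $n$ all-to-all pulse-coupled oscillators is the hybrid system $\mathcal H=(C,f,D,G)$ on $\mathbb R^n$ with flow set $C=[0,2\pi]^n$, flow $\dot x=f(x)=\omega(1,\dots,1)$ for $x\in C$, jump set $D=\{x\in C:\max_i x_i=2\pi\}$, and jumps $x^+\in G(x)$ for $x\in D$, where $G(x)=g_1(x)\times\dots\times g_n(x)$ with $$g_i(x)=\begin{cases}\{0\}& x_i=2\pi,\ x_j\ne2\pi\ \forall j\neq i,\\ \{x_i+Q(x_i)\}& x_i\neq 2\pi,\ \exists j\ne i:\ x_j=2\pi,\\ \{0,\,x_i+Q(x_i)\}& x_i=2\pi,\ \exists j\neq i:\ x_j=2\pi.\end{cases}$$ Solutions are hybrid arcs $\phi$ on hybrid time domains $\operatorname{dom}\phi\subset\mathbb R_{\ge0}\times\mathbb N_0$ in the standard sense of Goebel–Sanfelice–Teel: $\phi(0,0)\in\overline C\cup D$; for each $j$, $t\mapsto\phi(t,j)$ is locally absolutely continuous on $I^j=\{t:(t,j)\in\operatorname{dom}\phi\}$, lies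 in $C$ on the interior of $I^j$ and satisfies $\dot\phi=f(\phi)$ almost everywhere on $I^j$; and $\phi(t,j)\in D$, $\phi(t,j+1)\in G(\phi(t,j))$ whenever $(t,j),(t,j+1)\in\operatorname{dom}\phi$. A solution is maximal if it is not the truncation of another solution, and complete if its domain is unbounded. Let $\operatorname d(\theta_1,\theta_2)$ be the geodesic distance between $e^{i\theta_1}$ and $e^{i\theta_2}$ on the unit circle. The splay-state set is $$\mathcal A=\Big\{x\in C:\ \operatorname d(y_i,y_{i+1})=\tfrac{2\pi}{n}\ \text{ for } i=1,\dots,n\Big\},$$ where $y_1\le\dots\le y_n$ are the sorted entries of $x$ and $y_{n+1}=y_1$. Let $\mathcal X=\{x\in C:\exists\, i\ne j,\ \operatorname d(x_i,x_j)=0\}$ and $\mathcal U=C\setminus\mathcal X$. For a set $S\subset\mathbb R^n$, let $|x|_S=\inf_{y\in S}|x-y|$. A compact set $S$ is *stable* if for every $\varepsilon>0$ there is $\delta>0$ such that every solution with $|\phi(0,0)|_{S}\le\delta$ satisfies $|\phi(t,j)|_{S}\le\varepsilon$ on its whole domain; *locally attractive* if every maximal solution is complete and there is $\mu>0$ such that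 $\lim_{t+j\to\infty}|\phi(t,j)|_{S}=0$ for every maximal solution with $|\phi(0,0)|_{S}\le\mu$; *locally asymptotically stable* if it is both. Its basin of attraction is the set of points $\xi\in\mathbb R^n$ such that every maximal solution with $\phi(0,0)=\xi$ is bounded, complete and satisfies $\lim_{t+j\to\infty}|\phi(t,j)|_{S}=0$. (Points outside $C$, from which no solution starts, belong to it vacuously.) A compact, locally asymptotically stable set is *almost globally asymptotically stable* if the complement in $\mathbb R^n$ of its basin of attraction has Lebesgue measure zero. **Theorem.** Assume that $Q$ is continuous on $[0,2\pi]$ with $Q(2\pi)\ne0$, that $z\mapsto z+Q(z)$ is injective on $[0,2\pi]$, and that the graph of $Q$ lies in $\mathcal Q_1\cup\mathcal Q_2$, where $$\mathcal Q_1=\Big\{(w_1,w_2)\in\mathbb R^2: 0\le w_1\le\tfrac{2\pi(n-1)}n,\ w_2=0\Big\},$$ $$\mathcal Q_2=\Big\{(w_1,w_2)\in\mathbb R^2: \tfrac{2\pi(n-1)}n<w_1\le2\pi,\ \tfrac{2\pi(n-1)}n-w_1<w_2<0\Big\}.$$ Then $\mathcal A$ is almost globally asymptotically stable for $\mathcal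 H$, and the basin of attraction of $\mathcal A$ contains $\mathcal U$. -/

import Mathlib

open Set Filter Topology MeasureTheory

noncomputable section

namespace PCO

/-! ### Hybrid systems with state in `ℝⁿ` -/

/-- The data `(C, f, D, G)` of a hybrid system `ẋ = f x` for `x ∈ C`, `x⁺ ∈ G x` for `x ∈ D`. -/
structure HybridSystem (n : ℕ) where
  /-- flow set -/
  C : Set (EuclideanSpace ℝ (Fin n))
  /-- flow map -/
  f : EuclideanSpace ℝ (Fin n) → EuclideanSpace ℝ (Fin n)
  /-- jump set -/
  D : Set (EuclideanSpace ℝ (Fin n))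
  /-- set-valued jump map -/
  G : EuclideanSpace ℝ (Fin n) → Set (EuclideanSpace ℝ (Fin n))

/-- A compact hybrid time domain: `⋃_{j < J} [t_j, t_{j+1}] × {j}` for some `J ≥ 1` and
`0 = t_0 ≤ t_1 ≤ ⋯ ≤ t_J`. -/
def IsCompactHybridTimeDomain (E : Set (ℝ × ℕ)) : Prop :=
  ∃ (J : ℕ) (t : ℕ → ℝ), 0 < J ∧ t 0 = 0 ∧ Monotone t ∧
    E = {p | p.2 < J ∧ t p.2 ≤ p.1 ∧ p.1 ≤ t (p.2 + 1)}

/-- A (nonempty) hybrid time domain: a subset of `ℝ≥0 × ℕ` all of whose truncations are compact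
hybrid time domains. -/
def IsHybridTimeDomain (E : Set (ℝ × ℕ)) : Prop :=
  E.Nonempty ∧ (∀ p ∈ E, 0 ≤ p.1) ∧
    ∀ p ∈ E, IsCompactHybridTimeDomain {q | q ∈ E ∧ q.1 ≤ p.1 ∧ q.2 ≤ p.2}

/-- The interval `I^j = {t | (t, j) ∈ E}`. -/
def timeSlice (E : Set (ℝ × ℕ)) (j : ℕ) : Set ℝ := {t | (t, j) ∈ E}

/-- A hybrid arc: a function on a hybrid time domain such that, for every `j`, `t ↦ φ (t, j)` is
locally absolutely continuous on `I^j`. Only the values of `val` on `dom` are meaningful. -/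
structure HybridArc (n : ℕ) where
  /-- domain of the arc -/
  dom : Set (ℝ × ℕ)
  /-- value of the arc -/
  val : ℝ → ℕ → EuclideanSpace ℝ (Fin n)
  isHybridTimeDomain : IsHybridTimeDomain dom
  absolutelyContinuous : ∀ (j : ℕ) (a b : ℝ), a ≤ b → Icc a b ⊆ timeSlice dom j →
    AbsolutelyContinuousOnInterval (fun t => val t j) a b

namespace HybridArc

variable {n : ℕ}

/-- The range of a hybrid arc. -/
def rge (φ : HybridArc n) : Set (EuclideanSpace ℝ (Fin n)) :=
  {x | ∃ p ∈ φ.dom, φ.val p.1 p.2 = x}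

/-- `φ` is bounded. -/
def IsBounded (φ : HybridArc n) : Prop := Bornology.IsBounded φ.rge

/-- `φ` is complete: its domain is unbounded. -/
def IsComplete (φ : HybridArc n) : Prop := ¬ Bornology.IsBounded φ.dom

/-- `lim_{t + j → ∞} |φ(t, j)|_A = 0`. -/
def ConvergesTo (φ : HybridArc n) (A : Set (EuclideanSpace ℝ (Fin n))) : Prop :=
  ∀ ε > 0, ∃ T : ℝ, ∀ p ∈ φ.dom, T ≤ p.1 + (p.2 : ℝ) → Metric.infDist (φ.val p.1 p.2) A < ε

/-- `φ` is a truncation of `ψ`, and different from it. -/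
def IsProperTruncation (φ ψ : HybridArc n) : Prop :=
  φ.dom ⊂ ψ.dom ∧ ∀ p ∈ φ.dom, φ.val p.1 p.2 = ψ.val p.1 p.2

end HybridArc

namespace HybridSystem

variable {n : ℕ} (H : HybridSystem n)

/-- `φ` is a solution to the hybrid system `H`. -/
def IsSolution (φ : HybridArc n) : Prop :=
  φ.val 0 0 ∈ closure H.C ∪ H.D ∧
  (∀ j : ℕ,
    (∀ t ∈ interior (timeSlice φ.dom j), φ.val t j ∈ H.C) ∧
    ∀ᵐ t : ℝ, t ∈ interior (timeSlice φ.dom j) →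
      HasDerivAt (fun s => φ.val s j) (H.f (φ.val t j)) t) ∧
  ∀ (t : ℝ) (j : ℕ), (t, j) ∈ φ.dom → (t, j + 1) ∈ φ.dom →
    φ.val t j ∈ H.D ∧ φ.val t (j + 1) ∈ H.G (φ.val t j)

/-- `φ` is a maximal solution: it is not the truncation of another solution. -/
def IsMaximalSolution (φ : HybridArc n) : Prop :=
  H.IsSolution φ ∧ ∀ ψ : HybridArc n, H.IsSolution ψ → ¬ φ.IsProperTruncation ψ

/-- The set `A` is stable for `H`. -/
def IsStable (A : Set (EuclideanSpace ℝ (Fin n))) : Prop :=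
  ∀ ε > 0, ∃ δ > 0, ∀ φ : HybridArc n, H.IsSolution φ → Metric.infDist (φ.val 0 0) A ≤ δ →
    ∀ p ∈ φ.dom, Metric.infDist (φ.val p.1 p.2) A ≤ ε

/-- The set `A` is locally attractive for `H`. -/
def IsLocallyAttractive (A : Set (EuclideanSpace ℝ (Fin n))) : Prop :=
  (∀ φ : HybridArc n, H.IsMaximalSolution φ → φ.IsComplete) ∧
  ∃ μ > 0, ∀ φ : HybridArc n, H.IsMaximalSolution φ → Metric.infDist (φ.val 0 0) A ≤ μ →
    φ.ConvergesTo A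

/-- The set `A` is locally asymptotically stable for `H`. -/
def IsLAS (A : Set (EuclideanSpace ℝ (Fin n))) : Prop :=
  H.IsStable A ∧ H.IsLocallyAttractive A

/-- The basin of attraction of `A`: the points from which every maximal solution is bounded,
complete and converges to `A`. -/
def basin (A : Set (EuclideanSpace ℝ (Fin n))) : Set (EuclideanSpace ℝ (Fin n)) :=
  {ξ | ∀ φ : HybridArc n, H.IsMaximalSolution φ → φ.val 0 0 = ξ →
    φ.IsBounded ∧ φ.IsComplete ∧ φ.ConvergesTo A}

/-- The compact set `A` is almost globally asymptotically stable for `H`. -/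
def IsAGAS (A : Set (EuclideanSpace ℝ (Fin n))) : Prop :=
  IsCompact A ∧ H.IsLAS A ∧ volume (H.basin A)ᶜ = 0

end HybridSystem

/-! ### The network of pulse-coupled oscillators -/

variable (n : ℕ)

/-- The box `[0, 2π]ⁿ`. -/
def box : Set (EuclideanSpace ℝ (Fin n)) := {x | ∀ i, x i ∈ Icc 0 (2 * Real.pi)}

/-- The (set-valued) reset of the `i`-th oscillator. -/
def reset (Q : ℝ → ℝ) {n : ℕ} (x : EuclideanSpace ℝ (Fin n)) (i : Fin n) : Set ℝ :=
  {v | (x i = 2 * Real.pi ∧ (∀ j, j ≠ i → x j ≠ 2 * Real.pi) ∧ v = 0) ∨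
    (x i ≠ 2 * Real.pi ∧ (∃ j, j ≠ i ∧ x j = 2 * Real.pi) ∧ v = x i + Q (x i)) ∨
    (x i = 2 * Real.pi ∧ (∃ j, j ≠ i ∧ x j = 2 * Real.pi) ∧ (v = 0 ∨ v = x i + Q (x i)))}

/-- The hybrid system of `n` all-to-all pulse-coupled oscillators with natural frequency `ω` and
phase response function `Q`. -/
def network (ω : ℝ) (Q : ℝ → ℝ) : HybridSystem n where
  C := box n
  f := fun _ => WithLp.toLp 2 (fun _ => ω)
  D := {x | x ∈ box n ∧ IsGreatest (range fun i => x i) (2 * Real.pi)}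
  G := fun x => {y | ∀ i, y i ∈ reset Q x i}

/-- The geodesic distance between the points `e^{iθ₁}` and `e^{iθ₂}` of the unit circle. -/
def geodesicDist (θ₁ θ₂ : ℝ) : ℝ :=
  InnerProductGeometry.angle (Complex.exp (θ₁ * Complex.I)) (Complex.exp (θ₂ * Complex.I))

/-- The entries of `x` sorted from the smallest to the largest. -/
def sortVec {n : ℕ} (x : EuclideanSpace ℝ (Fin n)) : Fin n → ℝ :=
  (fun i => x i) ∘ Tuple.sort (fun i => x i)

/-- The splay-state set. The permutation `finRotate n` is `i ↦ i + 1`, the last index being sent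
to the first one. -/
def splaySet : Set (EuclideanSpace ℝ (Fin n)) :=
  {x | x ∈ box n ∧
    ∀ i, geodesicDist (sortVec x i) (sortVec x (finRotate n i)) = 2 * Real.pi / n}

/-- The configurations in which two oscillators have coinciding phases. -/
def coincidenceSet : Set (EuclideanSpace ℝ (Fin n)) :=
  {x | x ∈ box n ∧ ∃ i j, i ≠ j ∧ geodesicDist (x i) (x j) = 0}

/-- The part of the admissible graph where the phase is unaffected. -/
def Q₁ : Set (ℝ × ℝ) :=
  {w | w.1 ∈ Icc 0 (2 * Real.pi * (n - 1) / n) ∧ w.2 = 0}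

/-- The part of the admissible graph where the phase decreases, staying above `2π(n-1)/n`. -/
def Q₂ : Set (ℝ × ℝ) :=
  {w | w.1 ∈ Ioc (2 * Real.pi * (n - 1) / n) (2 * Real.pi) ∧
    2 * Real.pi * (n - 1) / n - w.1 < w.2 ∧ w.2 < 0}

end PCO

end

namespace PCO

/-! Put d = 2π/n and list the phases in decreasing cyclic order, lifted to ℝ. Up to a common shift,
flow followed by one pulse acts on this list as `returnMap`: the leader goes to the end and every
other phase passes through h(z) = z + Q(z). This h is increasing, fixes [0, 2π - d], and pulls each
later phase strictly back without leaving (2π - d, 2π].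

The Lyapunov function is `excess`, the sum of the positive parts of gap - d. No pulse increases it:
a gap either keeps its back end while its front end recedes, or ends up inside an arc shorter than d
(`excess_returnMap_le`). It strictly decreases when the front gap is < d and the second is > d
(`excess_returnMap_lt`). If it never decreases along an orbit, one gap < d forces every gap < d
after finitely many pulses, which is impossible because the gaps add up to n d
(`excess_eq_zero_of_const`). A LaSalle argument by compactness then sends the excess to 0
(`tendsto_excess_iterate`).

The excess bounds the distance to the splay set (`infDist_splaySet_le`), so its monotonicity gives
stability and its limit gives attraction. Starting without coincidences, order is preserved and two
oscillators never fire together, so each solution follows the return map (`exists_eq_iterate`).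
Maximal solutions jump infinitely often (`exists_mem_dom`), and coincidences form a null set. -/

/-- The post-pulse phase map `h` of an oscillator: it fixes the phases in `[0, 2π - d]`, and moves
the later ones backwards, but not below `2π - d`. -/
structure IsPhaseMap (d : ℝ) (h : ℝ → ℝ) : Prop where
  cont : Continuous h
  strictMono : StrictMonoOn h (Icc 0 (2 * Real.pi))
  eq_self : ∀ w, 0 ≤ w → w ≤ 2 * Real.pi - d → h w = w
  lt_apply : ∀ w, 2 * Real.pi - d < w → w ≤ 2 * Real.pi → 2 * Real.pi - d < h w
  apply_lt : ∀ w, 2 * Real.pi - d < w → w ≤ 2 * Real.pi → h w < w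

/-- The lifted phases of `n` oscillators in decreasing order, closed up by `y n = y 0 - 2π`. -/
structure IsCyclic (n : ℕ) (y : ℕ → ℝ) : Prop where
  le : ∀ k < n, y (k + 1) ≤ y k
  closed : y n = y 0 - 2 * Real.pi

/-- The ordered phases after the next pulse. -/
noncomputable def returnMap (n : ℕ) (h : ℝ → ℝ) (y : ℕ → ℝ) : ℕ → ℝ := fun k =>
  if k < n then h (y (k + 1) + (2 * Real.pi - y 0)) else h (y 1 + (2 * Real.pi - y 0)) - 2 * Real.pi

/-- The total excess of the phase gaps over `d`. -/
noncomputable def excess (n : ℕ) (d : ℝ) (y : ℕ → ℝ) : ℝ :=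
  ∑ k ∈ Finset.range n, max 0 (y k - y (k + 1) - d)

/-! ### Effect of one pulse on the phase gaps -/

section Gaps

variable {d : ℝ} {h : ℝ → ℝ}

namespace IsPhaseMap

theorem apply_le (H : IsPhaseMap d h) {w : ℝ} (h0 : 0 ≤ w) (h1 : w ≤ 2 * Real.pi) : h w ≤ w := by
  rcases le_or_gt w (2 * Real.pi - d) with hw | hw
  · exact (H.eq_self w h0 hw).le
  · exact (H.apply_lt w hw h1).le

theorem le_apply (H : IsPhaseMap d h) {w : ℝ} (hd : d ≤ 2 * Real.pi) (h0 : 2 * Real.pi - d ≤ w)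
    (h1 : w ≤ 2 * Real.pi) : 2 * Real.pi - d ≤ h w := by
  rcases h0.eq_or_lt with hw | hw
  · rw [H.eq_self w (by linarith) hw.ge]; exact h0
  · exact (H.lt_apply w hw h1).le

theorem apply_zero (H : IsPhaseMap d h) (hd : d ≤ 2 * Real.pi) : h 0 = 0 :=
  H.eq_self 0 le_rfl (by linarith)

theorem apply_nonneg (H : IsPhaseMap d h) (hd : d ≤ 2 * Real.pi) {w : ℝ} (h0 : 0 ≤ w)
    (h1 : w ≤ 2 * Real.pi) : 0 ≤ h w := by
  rcases le_or_gt w (2 * Real.pi - d) with hw | hw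
  · rw [H.eq_self w h0 hw]; exact h0
  · linarith [H.lt_apply w hw h1]

/-- If `b ≤ 2π - d`, the back end is fixed and the front end can only recede. Otherwise both images
lie in `(2π - d, 2π]`, so the new gap is below `d` and has no excess. -/
theorem gap_excess_le (H : IsPhaseMap d h) {a b : ℝ} (hb : 0 ≤ b)
    (hab : b ≤ a) (ha : a ≤ 2 * Real.pi) : max 0 (h a - h b - d) ≤ max 0 (a - b - d) := by
  rcases le_or_gt b (2 * Real.pi - d) with hw | hw
  · rw [H.eq_self b hb hw]
    have := H.apply_le (hb.trans hab) ha
    exact max_le_max le_rfl (by linarith)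
  · have h1 := H.lt_apply b hw (hab.trans ha)
    have h2 := H.apply_le (hb.trans hab) ha
    rw [max_eq_left (by linarith)]
    exact le_max_left _ _

/-- This gap, behind the firing oscillator, may widen, but only when `a > 2π - d`, and then `h a >
2π - d` keeps it below `d`. -/
theorem front_excess_le (H : IsPhaseMap d h) {a : ℝ} (h0 : 0 ≤ a) (ha : a ≤ 2 * Real.pi) :
    max 0 (2 * Real.pi - h a - d) ≤ max 0 (2 * Real.pi - a - d) := by
  rcases le_or_gt a (2 * Real.pi - d) with hw | hw
  · rw [H.eq_self a h0 hw]
  · have h1 := H.lt_apply a hw ha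
    rw [max_eq_left (by linarith)]
    exact le_max_left _ _

theorem gap_lt (H : IsPhaseMap d h) {a b : ℝ} (hb : 0 ≤ b)
    (hab : b ≤ a) (ha : a ≤ 2 * Real.pi) (hg : a - b < d) : h a - h b < d := by
  have h2 := H.apply_le (hb.trans hab) ha
  rcases le_or_gt b (2 * Real.pi - d) with hw | hw
  · rw [H.eq_self b hb hw]; linarith
  · linarith [H.lt_apply b hw (hab.trans ha)]

theorem front_lt (H : IsPhaseMap d h) {a : ℝ} (ha : a ≤ 2 * Real.pi) (hg : 2 * Real.pi - a < d) :
    2 * Real.pi - h a < d := by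
  linarith [H.lt_apply a (by linarith) ha]

/-- The second gap may equal `d`: a short front gap means that `a` is pulled back strictly, which
makes the inequality strict. This is how shortness spreads from one gap to the next. -/
theorem second_lt (H : IsPhaseMap d h) (hd : d ≤ 2 * Real.pi) {a b : ℝ} (hb : 0 ≤ b)
    (hab : b ≤ a) (ha : a ≤ 2 * Real.pi) (h1 : 2 * Real.pi - a < d) (h2 : a - b ≤ d) :
    h a - h b < d := by
  have h3 := H.apply_lt a (by linarith) ha
  rcases le_or_gt (2 * Real.pi - d) b with hw | hw
  · linarith [H.le_apply hd hw (hab.trans ha)]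
  · rw [H.eq_self b hb hw.le]; linarith

/-- The source of strict decrease: `b` lies below `2π - d` and stays put, while `a` recedes. -/
theorem second_excess_lt (H : IsPhaseMap d h) {a b : ℝ} (hb : 0 ≤ b)
    (ha : a ≤ 2 * Real.pi) (h1 : 2 * Real.pi - a < d) (h2 : d < a - b) :
    max 0 (h a - h b - d) < max 0 (a - b - d) := by
  have h3 := H.apply_lt a (by linarith) ha
  rw [H.eq_self b hb (by linarith)]
  exact max_lt (lt_max_of_lt_right (by linarith)) (lt_max_of_lt_right (by linarith))

end IsPhaseMap

variable {n : ℕ} {y : ℕ → ℝ}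

theorem IsCyclic.antitone (hy : IsCyclic n y) {a b : ℕ} (hab : a ≤ b) (hb : b ≤ n) : y b ≤ y a := by
  induction b, hab using Nat.le_induction with
  | base => exact le_rfl
  | succ b hab ih => exact (hy.le b hb).trans (ih (by omega))

theorem IsCyclic.shift_le (hy : IsCyclic n y) {k : ℕ} (hk : k ≤ n) :
    y k + (2 * Real.pi - y 0) ≤ 2 * Real.pi := by
  linarith [hy.antitone (Nat.zero_le k) hk]

theorem IsCyclic.shift_nonneg (hy : IsCyclic n y) {k : ℕ} (hk : k ≤ n) :
    0 ≤ y k + (2 * Real.pi - y 0) := by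
  linarith [hy.antitone hk le_rfl, hy.closed]

theorem excess_nonneg : 0 ≤ excess n d y := Finset.sum_nonneg fun _ _ => le_max_left _ _

theorem sum_gaps_sub (hd : n * d = 2 * Real.pi) (hy : IsCyclic n y) :
    ∑ k ∈ Finset.range n, (y k - y (k + 1) - d) = 0 := by
  rw [Finset.sum_sub_distrib, Finset.sum_range_sub', hy.closed]
  simp [hd]

theorem returnMap_of_lt {k : ℕ} (hk : k < n) :
    returnMap n h y k = h (y (k + 1) + (2 * Real.pi - y 0)) := if_pos hk

theorem returnMap_self : returnMap n h y n = h (y 1 + (2 * Real.pi - y 0)) - 2 * Real.pi :=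
  if_neg (lt_irrefl n)

/-- The fired oscillator appears as `y (n + 1) = y 0 - 2π`, of shifted phase `0`. Since `h 0 = 0`,
its reset to `0` follows the same formula as the other phases. -/
theorem returnMap_last (H : IsPhaseMap d h) (hd : d ≤ 2 * Real.pi) (hy : IsCyclic (n + 1) y) :
    returnMap (n + 1) h y n = 0 := by
  rw [returnMap_of_lt n.lt_succ_self, hy.closed]
  ring_nf
  exact H.apply_zero hd

theorem isCyclic_returnMap (H : IsPhaseMap d h) (hd : d ≤ 2 * Real.pi) (hy : IsCyclic (n + 1) y) :
    IsCyclic (n + 1) (returnMap (n + 1) h y) := by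
  refine ⟨fun k hk => ?_, ?_⟩
  · rcases Nat.lt_succ_iff_lt_or_eq.1 hk with hk' | rfl
    · rw [returnMap_of_lt hk, returnMap_of_lt (by omega)]
      exact H.strictMono.monotoneOn ⟨hy.shift_nonneg (by omega), hy.shift_le (by omega)⟩
        ⟨hy.shift_nonneg (by omega), hy.shift_le (by omega)⟩
        (by linarith [hy.le (k + 1) (by omega)])
    · rw [returnMap_last H hd hy, returnMap_self]
      linarith [H.apply_le (hy.shift_nonneg (k := 1) (by omega)) (hy.shift_le (by omega)),
        hy.shift_le (k := 1) (by omega)]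
  · rw [returnMap_self, returnMap_of_lt (by omega)]

theorem returnMap_strict (H : IsPhaseMap d h) (hd : d ≤ 2 * Real.pi)
    (hy : IsCyclic (n + 1) y) (hs : ∀ k < n + 1, y (k + 1) < y k) :
    ∀ k < n + 1, returnMap (n + 1) h y (k + 1) < returnMap (n + 1) h y k := by
  intro k hk
  rcases Nat.lt_succ_iff_lt_or_eq.1 hk with hk' | rfl
  · rw [returnMap_of_lt hk, returnMap_of_lt (by omega)]
    exact H.strictMono ⟨hy.shift_nonneg (by omega), hy.shift_le (by omega)⟩
      ⟨hy.shift_nonneg (by omega), hy.shift_le (by omega)⟩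
      (by linarith [hs (k + 1) (by omega)])
  · rw [returnMap_last H hd hy, returnMap_self]
    linarith [H.apply_le (hy.shift_nonneg (k := 1) (by omega)) (hy.shift_le (by omega)),
      hs 0 (by omega)]

/-- The gaps following the first one are moved one place to the front. -/
theorem returnMap_gap {k : ℕ} (hk : k < n) :
    returnMap (n + 1) h y k - returnMap (n + 1) h y (k + 1) =
      h (y (k + 1) + (2 * Real.pi - y 0)) - h (y (k + 2) + (2 * Real.pi - y 0)) := by
  rw [returnMap_of_lt (by omega), returnMap_of_lt (by omega)]

/-- The first gap is moved to the end. -/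
theorem returnMap_gap_last (H : IsPhaseMap d h) (hd : d ≤ 2 * Real.pi) (hy : IsCyclic (n + 1) y) :
    returnMap (n + 1) h y n - returnMap (n + 1) h y (n + 1) =
      2 * Real.pi - h (y 1 + (2 * Real.pi - y 0)) := by
  rw [returnMap_last H hd hy, returnMap_self]; ring

theorem returnMap_gap_excess_le (H : IsPhaseMap d h)
    (hy : IsCyclic (n + 1) y) {k : ℕ} (hk : k < n) :
    max 0 (returnMap (n + 1) h y k - returnMap (n + 1) h y (k + 1) - d) ≤
      max 0 (y (k + 1) - y (k + 1 + 1) - d) := by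
  rw [returnMap_gap hk]
  refine (H.gap_excess_le (hy.shift_nonneg (by omega))
    (by linarith [hy.le (k + 1) (by omega)]) (hy.shift_le (by omega))).trans (le_of_eq ?_)
  congr 1; ring

theorem returnMap_last_excess_le (H : IsPhaseMap d h) (hd : d ≤ 2 * Real.pi)
    (hy : IsCyclic (n + 1) y) :
    max 0 (returnMap (n + 1) h y n - returnMap (n + 1) h y (n + 1) - d) ≤
      max 0 (y 0 - y 1 - d) := by
  rw [returnMap_gap_last H hd hy]
  refine (H.front_excess_le (hy.shift_nonneg (by omega)) (hy.shift_le (by omega))).trans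
    (le_of_eq ?_)
  congr 1; ring

/-- The two sums are compared after a cyclic shift: the first gap before the pulse is matched with
the last one after it. -/
theorem excess_returnMap_le (H : IsPhaseMap d h) (hd : d ≤ 2 * Real.pi)
    (hy : IsCyclic (n + 1) y) : excess (n + 1) d (returnMap (n + 1) h y) ≤ excess (n + 1) d y := by
  rw [excess, excess, Finset.sum_range_succ, Finset.sum_range_succ' _ n]
  exact add_le_add (Finset.sum_le_sum fun k hk =>
    returnMap_gap_excess_le H hy (Finset.mem_range.1 hk)) (returnMap_last_excess_le H hd hy)

theorem excess_returnMap_lt (H : IsPhaseMap d h) (hd : d ≤ 2 * Real.pi)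
    (hy : IsCyclic (n + 1) y) (hn : 0 < n) (h1 : y 0 - y 1 < d) (h2 : d < y 1 - y 2) :
    excess (n + 1) d (returnMap (n + 1) h y) < excess (n + 1) d y := by
  rw [excess, excess, Finset.sum_range_succ, Finset.sum_range_succ' _ n]
  refine add_lt_add_of_lt_of_le (Finset.sum_lt_sum (fun k hk =>
    returnMap_gap_excess_le H hy (Finset.mem_range.1 hk)) ⟨0, Finset.mem_range.2 hn, ?_⟩)
    (returnMap_last_excess_le H hd hy)
  rw [returnMap_gap hn]
  refine (H.second_excess_lt (hy.shift_nonneg (by omega)) (hy.shift_le (by omega))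
    (by simp only [zero_add]; linarith) (by simp only [zero_add]; linarith)).trans_eq ?_
  congr 1; ring

theorem returnMap_gap_lt (H : IsPhaseMap d h) (hy : IsCyclic (n + 1) y) {k : ℕ} (hk : k < n)
    (hg : y (k + 1) - y (k + 2) < d) :
    returnMap (n + 1) h y k - returnMap (n + 1) h y (k + 1) < d := by
  rw [returnMap_gap hk]
  exact H.gap_lt (hy.shift_nonneg (by omega)) (by linarith [hy.le (k + 1) (by omega)])
    (hy.shift_le (by omega)) (by linarith)

theorem returnMap_gap_last_lt (H : IsPhaseMap d h) (hd : d ≤ 2 * Real.pi)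
    (hy : IsCyclic (n + 1) y) (hg : y 0 - y 1 < d) :
    returnMap (n + 1) h y n - returnMap (n + 1) h y (n + 1) < d := by
  rw [returnMap_gap_last H hd hy]
  exact H.front_lt (hy.shift_le (by omega)) (by linarith)

theorem returnMap_gap_zero_lt (H : IsPhaseMap d h) (hd : d ≤ 2 * Real.pi)
    (hy : IsCyclic (n + 1) y) (hn : 0 < n) (h1 : y 0 - y 1 < d) (h2 : y 1 - y 2 ≤ d) :
    returnMap (n + 1) h y 0 - returnMap (n + 1) h y 1 < d := by
  have := returnMap_gap (h := h) (y := y) hn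
  rw [zero_add] at this
  rw [this]
  exact H.second_lt hd (hy.shift_nonneg (by omega)) (by linarith [hy.le 1 (by omega)])
    (hy.shift_le (by omega)) (by linarith) (by linarith)

end Gaps

/-! ### Orbits of the return map and the LaSalle argument -/

section Orbits

variable {d : ℝ} {h : ℝ → ℝ} {n : ℕ} {y : ℕ → ℝ}

theorem isCyclic_iterate (H : IsPhaseMap d h) (hd : d ≤ 2 * Real.pi) (hy : IsCyclic (n + 1) y)
    (j : ℕ) : IsCyclic (n + 1) ((returnMap (n + 1) h)^[j] y) := by
  induction j with
  | zero => exact hy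
  | succ j ih => rw [Function.iterate_succ_apply']; exact isCyclic_returnMap H hd ih

theorem iterate_strict (H : IsPhaseMap d h) (hd : d ≤ 2 * Real.pi)
    (hy : IsCyclic (n + 1) y) (hs : ∀ k < n + 1, y (k + 1) < y k) (j : ℕ) :
    ∀ k < n + 1, (returnMap (n + 1) h)^[j] y (k + 1) < (returnMap (n + 1) h)^[j] y k := by
  induction j with
  | zero => exact hs
  | succ j ih =>
    rw [Function.iterate_succ_apply']
    exact returnMap_strict H hd (isCyclic_iterate H hd hy j) ih

theorem excess_iterate_antitone (H : IsPhaseMap d h) (hd : d ≤ 2 * Real.pi)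
    (hy : IsCyclic (n + 1) y) : Antitone fun j => excess (n + 1) d ((returnMap (n + 1) h)^[j] y) :=
  antitone_nat_of_succ_le fun j => by
    rw [Function.iterate_succ_apply']
    exact excess_returnMap_le H hd (isCyclic_iterate H hd hy j)

theorem exists_gap_lt (hd : n * d = 2 * Real.pi) (hy : IsCyclic n y) (hV : 0 < excess n d y) :
    ∃ k < n, y k - y (k + 1) < d := by
  by_contra! hge
  have h0 := sum_gaps_sub hd hy
  refine hV.ne' (h0 ▸ Finset.sum_congr rfl fun k hk => max_eq_right ?_)
  linarith [hge k (Finset.mem_range.1 hk)]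

theorem exists_le_gap (hd : n * d = 2 * Real.pi) (hn : 0 < n) (hy : IsCyclic n y) :
    ∃ k < n, d ≤ y k - y (k + 1) := by
  by_contra! hlt
  refine (sum_gaps_sub hd hy).not_lt
    (Finset.sum_neg (fun k hk => ?_) ⟨0, Finset.mem_range.2 hn⟩)
  linarith [hlt k (Finset.mem_range.1 hk)]

/-- Each pulse moves a gap one place towards the front, and a short gap stays short on the way. -/
theorem iterate_gap_lt (H : IsPhaseMap d h) (hd : d ≤ 2 * Real.pi) (hy : IsCyclic (n + 1) y)
    {k : ℕ} (j : ℕ) (hk : k + j < n + 1) (hg : y (k + j) - y (k + j + 1) < d) :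
    (returnMap (n + 1) h)^[j] y k - (returnMap (n + 1) h)^[j] y (k + 1) < d := by
  induction j generalizing k with
  | zero => exact hg
  | succ j ih =>
    rw [Function.iterate_succ_apply']
    refine returnMap_gap_lt H (isCyclic_iterate H hd hy j) (by omega) (ih (by omega) ?_)
    convert hg using 3 <;> ring_nf

/-- If the excess never decreases, then it is zero: a gap shorter than `d` would make all the
others shorter than `d`. -/
theorem excess_eq_zero_of_const (H : IsPhaseMap d h) (hd : (n + 1 : ℕ) * d = 2 * Real.pi)
    (hd' : d ≤ 2 * Real.pi) (hn : 0 < n) (hy : IsCyclic (n + 1) y)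
    (hc : ∀ j, excess (n + 1) d ((returnMap (n + 1) h)^[j] y) = excess (n + 1) d y) :
    excess (n + 1) d y = 0 := by
  by_contra hV
  obtain ⟨k, hk, hgk⟩ := exists_gap_lt hd hy (excess_nonneg.lt_of_ne' hV)
  set z := fun j => (returnMap (n + 1) h)^[j] y with hz
  have hzc : ∀ j, IsCyclic (n + 1) (z j) := isCyclic_iterate H hd' hy
  have hzs : ∀ j, z (j + 1) = returnMap (n + 1) h (z j) := fun j =>
    Function.iterate_succ_apply' _ _ _
  -- From time `k` on the front gap is always short: a second gap longer than `d` would lower the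
  -- excess, so it is at most `d` and arrives at the front shorter than `d`.
  have hfront : ∀ j, z (k + j) 0 - z (k + j) 1 < d := by
    intro j
    induction j with
    | zero =>
      exact iterate_gap_lt H hd' hy (k := 0) k (by omega) (by rwa [zero_add])
    | succ j ih =>
      rw [← add_assoc, hzs]
      refine returnMap_gap_zero_lt H hd' (hzc _) hn ih (le_of_not_gt fun h2 => ?_)
      have := excess_returnMap_lt H hd' (hzc _) hn ih h2
      rw [← hzs] at this
      exact this.ne ((hc _).trans (hc _).symm)
  -- The gap in place `i` at time `k + n + 1` was the front gap at time `k + i`; one pulse sent it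
  -- to place `n`, and `n - i` more brought it to place `i`. Hence it is short, whatever `i` is.
  obtain ⟨i, hi, hgi⟩ := exists_le_gap hd n.succ_pos (hzc (k + (n + 1)))
  refine hgi.not_gt ?_
  have hlast := returnMap_gap_last_lt H hd' (hzc _) (hfront i)
  rw [← hzs] at hlast
  have := iterate_gap_lt H hd' (hzc (k + i + 1)) (k := i) (n - i) (by omega)
    (by rwa [show i + (n - i) = n by omega])
  have he : k + (n + 1) = (n - i) + (k + i + 1) := by omega
  rw [he]
  simpa only [hz, Function.iterate_add_apply] using this

theorem continuous_returnMap (H : IsPhaseMap d h) : Continuous (returnMap n h) := by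
  refine continuous_pi fun k => ?_
  have := H.cont
  unfold returnMap
  split_ifs <;> fun_prop

theorem continuous_excess : Continuous (excess n d) := by
  unfold excess
  fun_prop

theorem returnMap_mem_Icc (H : IsPhaseMap d h) (hd : d ≤ 2 * Real.pi) (hy : IsCyclic (n + 1) y)
    (k : ℕ) : returnMap (n + 1) h y k ∈ Icc (-(2 * Real.pi)) (2 * Real.pi) := by
  have hpi := Real.pi_pos
  have key : ∀ i ≤ n + 1, h (y i + (2 * Real.pi - y 0)) ∈ Icc 0 (2 * Real.pi) := fun i hi =>
    ⟨H.apply_nonneg hd (hy.shift_nonneg hi) (hy.shift_le hi),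
      (H.apply_le (hy.shift_nonneg hi) (hy.shift_le hi)).trans (hy.shift_le hi)⟩
  unfold returnMap
  split_ifs with hk
  · have := key (k + 1) (by omega)
    exact ⟨by linarith [this.1], this.2⟩
  · have := key 1 (by omega)
    exact ⟨by linarith [this.1], by linarith [this.2]⟩

theorem isClosed_isCyclic : IsClosed {y | IsCyclic n y} := by
  have : {y | IsCyclic n y} =
      (⋂ k, ⋂ (_ : k < n), {y : ℕ → ℝ | y (k + 1) ≤ y k}) ∩ {y | y n = y 0 - 2 * Real.pi} := by
    ext y
    simp only [mem_ofPred_eq, mem_inter_iff, mem_iInter]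
    exact ⟨fun h => ⟨h.1, h.2⟩, fun h => ⟨h.1, h.2⟩⟩
  rw [this]
  exact (isClosed_iInter fun k => isClosed_iInter fun _ =>
    isClosed_le (by fun_prop) (by fun_prop)).inter (isClosed_eq (by fun_prop) (by fun_prop))

/-- Along the orbit of a limit point the excess is constant, hence zero. Phases may merge in the
limit, so only the weak ordering of `IsCyclic`, a closed condition, is used. -/
theorem tendsto_excess_iterate (H : IsPhaseMap d h) (hd : (n + 1 : ℕ) * d = 2 * Real.pi)
    (hd' : d ≤ 2 * Real.pi) (hn : 0 < n) (hy : IsCyclic (n + 1) y) :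
    Tendsto (fun j => excess (n + 1) d ((returnMap (n + 1) h)^[j] y)) atTop (𝓝 0) := by
  set P := returnMap (n + 1) h with hP
  set v := fun j => excess (n + 1) d (P^[j] y) with hv
  have hanti : Antitone v := excess_iterate_antitone H hd' hy
  have hlim : Tendsto v atTop (𝓝 (⨅ j, v j)) :=
    tendsto_atTop_ciInf hanti ⟨0, by rintro _ ⟨j, rfl⟩; exact excess_nonneg⟩
  have hK : IsCompact ({y | IsCyclic (n + 1) y} ∩
      Set.univ.pi fun _ : ℕ => Icc (-(2 * Real.pi)) (2 * Real.pi)) :=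
    (isCompact_univ_pi fun _ => isCompact_Icc).inter_left isClosed_isCyclic
  -- The orbit is taken from its first iterate on, because `y` itself need not be bounded; after one
  -- application all coordinates, even those beyond `n + 1`, lie in `[-2π, 2π]`.
  obtain ⟨z, hz, φ, hφ, hφz⟩ := hK.tendsto_subseq (x := fun j => P^[j + 1] y) fun j =>
    ⟨isCyclic_iterate H hd' hy _, fun k _ => by
      rw [Function.iterate_succ_apply']
      exact returnMap_mem_Icc H hd' (isCyclic_iterate H hd' hy j) k⟩
  have hPc : Continuous P := continuous_returnMap H
  have hconst : ∀ m, excess (n + 1) d (P^[m] z) = ⨅ j, v j := by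
    intro m
    have h1 := ((continuous_excess (n := n + 1) (d := d)).comp (hPc.iterate m)).continuousAt.tendsto.comp hφz
    refine tendsto_nhds_unique h1 ?_
    have h2 : Tendsto (fun j => m + (φ j + 1)) atTop atTop :=
      tendsto_atTop_mono (fun j => by omega) hφ.tendsto_atTop
    refine (hlim.comp h2).congr fun j => ?_
    simp only [hv, Function.comp_apply, Function.iterate_add_apply P m]
  have := excess_eq_zero_of_const H hd hd' hn hz.1 fun j =>
    (hconst j).trans (hconst 0).symm
  rwa [show (⨅ j, v j) = 0 from (hconst 0).symm.trans this] at hlim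

end Orbits

end PCO
namespace PCO

/-! ### Geometry of the splay set -/

section Splay

theorem geodesicDist_comm (a b : ℝ) : geodesicDist a b = geodesicDist b a :=
  InnerProductGeometry.angle_comm _ _

theorem geodesicDist_eq_min {a b : ℝ} (h0 : 0 ≤ a - b) (h1 : a - b ≤ 2 * Real.pi) :
    geodesicDist a b = min (a - b) (2 * Real.pi - (a - b)) := by
  have hpi := Real.pi_pos
  rw [geodesicDist, Complex.angle_exp_exp]
  rcases le_or_gt (a - b) Real.pi with h | h
  · rw [(toIocMod_eq_self Real.two_pi_pos).2 ⟨by linarith, by linarith⟩, abs_of_nonneg h0,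
      min_eq_left (by linarith)]
  · rw [(toIocMod_eq_iff Real.two_pi_pos).2
      (⟨⟨by linarith, by linarith⟩, 1, by simp⟩ :
        a - b - 2 * Real.pi ∈ Ioc _ _ ∧ ∃ z : ℤ, a - b = a - b - 2 * Real.pi + z • (2 * Real.pi)),
      abs_of_nonpos (by linarith), min_eq_right (by linarith)]
    ring

variable {m : ℕ}

/-- The angular spacing of a splay state. -/
noncomputable def spacing (m : ℕ) : ℝ := 2 * Real.pi / (m + 1 : ℕ)

theorem spacing_pos : 0 < spacing m := by
  unfold spacing; positivity

theorem mul_spacing : (m + 1 : ℕ) * spacing m = 2 * Real.pi := by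
  unfold spacing; field_simp

theorem mul_spacing' : (m : ℝ) * spacing m = 2 * Real.pi - spacing m := by
  have := mul_spacing (m := m)
  push_cast at this
  linarith

theorem spacing_le (hm : 0 < m) : 2 * spacing m ≤ 2 * Real.pi := by
  have h := mul_spacing' (m := m)
  have h1 : (1 : ℝ) ≤ m := by exact_mod_cast hm
  nlinarith [spacing_pos (m := m)]

theorem mul_spacing_le {k : ℕ} (hk : k ≤ m) : (k : ℝ) * spacing m ≤ 2 * Real.pi - spacing m := by
  rw [← mul_spacing']
  exact mul_le_mul_of_nonneg_right (by exact_mod_cast hk) spacing_pos.le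

theorem mem_splaySet_of_perm (hm : 0 < m) {x : EuclideanSpace ℝ (Fin (m + 1))}
    (σ : Equiv.Perm (Fin (m + 1))) {s : ℝ} (hs : s ∈ Icc 0 (spacing m))
    (hx : ∀ k, x (σ k) = s + (k : ℕ) * spacing m) : x ∈ splaySet (m + 1) := by
  have hd := spacing_pos (m := m)
  have hd2 := spacing_le hm
  have hsort : sortVec x = fun k : Fin (m + 1) => s + (k : ℕ) * spacing m := by
    have hmono : Monotone ((fun i => x i) ∘ σ) := by
      intro i j hij
      simp only [Function.comp_apply, hx]
      have : ((i : ℕ) : ℝ) ≤ (j : ℕ) := by exact_mod_cast hij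
      nlinarith
    rw [sortVec, ← Tuple.comp_sort_eq_comp_iff_monotone.2 hmono]
    exact funext hx
  refine ⟨fun i => ?_, fun i => ?_⟩
  · obtain ⟨k, rfl⟩ := σ.surjective i
    rw [hx]
    have h1 := mul_spacing_le (Nat.le_of_lt_succ k.isLt)
    have h2 : 0 ≤ ((k : ℕ) : ℝ) * spacing m := by positivity
    exact ⟨by linarith [hs.1], by linarith [hs.2]⟩
  · rw [hsort]
    change _ = spacing m
    cases i using Fin.lastCases with
    | last =>
      have h := mul_spacing' (m := m)
      simp only [finRotate_last, Fin.val_last, Fin.val_zero, Nat.cast_zero, zero_mul, add_zero]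
      rw [geodesicDist_eq_min (by linarith) (by linarith), min_eq_right (by linarith)]
      linarith
    | cast i =>
      have h : (finRotate (m + 1)) i.castSucc = i.succ := finRotate_of_lt i.isLt
      simp only [h, Fin.val_castSucc, Fin.val_succ, Nat.cast_add, Nat.cast_one]
      rw [geodesicDist_comm, geodesicDist_eq_min (by linarith) (by linarith),
        min_eq_left (by linarith)]
      ring

/-- A geodesic distance `d` only gives that consecutive sorted entries differ by at least `d`. The
closing condition bounds the total spread by `2π - d = m d`, so all `m` differences equal `d`. -/
theorem exists_perm_of_mem_splaySet (hm : 0 < m) {x : EuclideanSpace ℝ (Fin (m + 1))}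
    (hx : x ∈ splaySet (m + 1)) : ∃ σ : Equiv.Perm (Fin (m + 1)), ∃ s ∈ Icc 0 (spacing m),
      ∀ k, x (σ k) = s + (k : ℕ) * spacing m := by
  have hd := spacing_pos (m := m)
  have hd2 := spacing_le hm
  have hmd := mul_spacing' (m := m)
  set w := sortVec x with hw
  have hmono : Monotone w := Tuple.monotone_sort _
  have hbox : ∀ i, w i ∈ Icc 0 (2 * Real.pi) := fun i => hx.1 _
  have hgap : ∀ i : Fin m, w i.castSucc + spacing m ≤ w i.succ := by
    intro i
    have h := hx.2 i.castSucc
    rw [show (finRotate (m + 1)) i.castSucc = i.succ from finRotate_of_lt i.isLt,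
      geodesicDist_comm, geodesicDist_eq_min (sub_nonneg.2 (hmono i.castSucc_lt_succ.le))
      (by linarith [(hbox i.succ).2, (hbox i.castSucc).1])] at h
    change _ = spacing m at h
    linarith [min_le_left (w i.succ - w i.castSucc) (2 * Real.pi - (w i.succ - w i.castSucc))]
  have htot : w (Fin.last m) - w 0 ≤ 2 * Real.pi - spacing m := by
    have h := hx.2 (Fin.last m)
    rw [finRotate_last, geodesicDist_eq_min (sub_nonneg.2 (hmono (Fin.zero_le _)))
      (by linarith [(hbox (Fin.last m)).2, (hbox 0).1])] at h
    change _ = spacing m at h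
    linarith [min_le_right (w (Fin.last m) - w 0) (2 * Real.pi - (w (Fin.last m) - w 0))]
  have hlow : ∀ i : Fin (m + 1), w 0 + (i : ℕ) * spacing m ≤ w i := by
    intro i
    induction i using Fin.induction with
    | zero => simp
    | succ i ih =>
      have := hgap i
      simp only [Fin.val_castSucc, Fin.val_succ, Nat.cast_add, Nat.cast_one] at ih ⊢
      linarith
  have hup : ∀ i : Fin (m + 1), w i + (m - (i : ℕ)) * spacing m ≤ w (Fin.last m) := by
    intro i
    induction i using Fin.reverseInduction with
    | last => simp
    | cast i ih =>
      have := hgap i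
      simp only [Fin.val_castSucc, Fin.val_succ, Nat.cast_add, Nat.cast_one] at ih ⊢
      linarith
  refine ⟨Tuple.sort fun i => x i, w 0, ⟨(hbox 0).1, ?_⟩, fun k => ?_⟩
  · have := hlow (Fin.last m)
    have := (hbox (Fin.last m)).2
    simp only [Fin.val_last] at *
    linarith
  · change w k = _
    linarith [hlow k, hup k]

/-- A finite union of segments, from which compactness and nonemptiness are read off. -/
theorem splaySet_eq_iUnion (hm : 0 < m) : splaySet (m + 1) =
    ⋃ σ : Equiv.Perm (Fin (m + 1)), (fun s : ℝ => (WithLp.toLp 2 fun i =>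
      s + (σ.symm i : ℕ) * spacing m : EuclideanSpace ℝ (Fin (m + 1)))) '' Icc 0 (spacing m) := by
  ext x
  simp only [mem_iUnion, mem_image]
  constructor
  · intro hx
    obtain ⟨σ, s, hs, h⟩ := exists_perm_of_mem_splaySet hm hx
    refine ⟨σ, s, hs, ?_⟩
    ext i
    simp [← h]
  · rintro ⟨σ, s, hs, rfl⟩
    exact mem_splaySet_of_perm hm σ hs fun k => by simp

theorem isCompact_splaySet (hm : 0 < m) : IsCompact (splaySet (m + 1)) := by
  rw [splaySet_eq_iUnion hm]
  refine isCompact_iUnion fun σ => isCompact_Icc.image ?_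
  fun_prop

theorem splaySet_nonempty (hm : 0 < m) : (splaySet (m + 1)).Nonempty := by
  rw [splaySet_eq_iUnion hm]
  exact ⟨_, mem_iUnion.2 ⟨1, mem_image_of_mem _ (left_mem_Icc.2 spacing_pos.le)⟩⟩

end Splay

/-! ### Cyclic enumerations of the oscillators -/

section Enumeration

variable {m : ℕ}

/-- A periodic enumeration of the oscillators. -/
structure IsEnum (n : ℕ) (e : ℕ → Fin n) : Prop where
  periodic : ∀ k, e (k + n) = e k
  surj : ∀ i, ∃ k < n, e k = i

theorem IsEnum.succ {e : ℕ → Fin (m + 1)} (he : IsEnum (m + 1) e) :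
    IsEnum (m + 1) fun k => e (k + 1) := by
  refine ⟨fun k => ?_, fun i => ?_⟩
  · rw [← he.periodic (k + 1)]; congr 1; omega
  · obtain ⟨k, hk, rfl⟩ := he.surj i
    rcases k with _ | k
    · exact ⟨m, by omega, by simpa using he.periodic 0⟩
    · exact ⟨k, by omega, rfl⟩

theorem IsEnum.add {e : ℕ → Fin (m + 1)} (he : IsEnum (m + 1) e) (j : ℕ) :
    IsEnum (m + 1) fun k => e (k + j) := by
  induction j with
  | zero => exact he
  | succ j ih => simpa only [add_assoc, add_comm 1 j] using ih.succ

/-- The oscillators in the reverse of the order given by `σ`. -/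
def revEnum (σ : Equiv.Perm (Fin (m + 1))) (k : ℕ) : Fin (m + 1) :=
  σ (Fin.rev (Fin.ofNat (m + 1) k))

theorem revEnum_of_lt (σ : Equiv.Perm (Fin (m + 1))) {k : ℕ} (hk : k < m + 1) :
    revEnum σ k = σ ⟨m - k, by omega⟩ := by
  refine congrArg σ (Fin.ext ?_)
  rw [Fin.val_rev, Fin.val_ofNat, Nat.mod_eq_of_lt hk]
  change _ = m - k
  omega

theorem isEnum_revEnum (σ : Equiv.Perm (Fin (m + 1))) : IsEnum (m + 1) (revEnum σ) := by
  refine ⟨fun k => ?_, fun i => ⟨(Fin.rev (σ.symm i) : Fin (m + 1)), Fin.isLt _, ?_⟩⟩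
  · simp [revEnum, Fin.ofNat]
  · rw [revEnum_of_lt σ (Fin.isLt _)]
    refine (congrArg σ (Fin.ext ?_)).trans (σ.apply_symm_apply i)
    simp only [Fin.val_rev]
    omega

/-- The phases listed in the order `e`, lifted to `ℝ`. -/
noncomputable def liftPhases (x : EuclideanSpace ℝ (Fin (m + 1))) (e : ℕ → Fin (m + 1)) (k : ℕ) :
    ℝ := x (e k) - 2 * Real.pi * (k / (m + 1) : ℕ)

theorem liftPhases_of_lt {x : EuclideanSpace ℝ (Fin (m + 1))} {e : ℕ → Fin (m + 1)} {k : ℕ}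
    (hk : k < m + 1) : liftPhases x e k = x (e k) := by
  simp [liftPhases, Nat.div_eq_of_lt hk]

theorem liftPhases_self {x : EuclideanSpace ℝ (Fin (m + 1))} {e : ℕ → Fin (m + 1)}
    (he : IsEnum (m + 1) e) : liftPhases x e (m + 1) = liftPhases x e 0 - 2 * Real.pi := by
  have := he.periodic 0
  rw [zero_add] at this
  simp [liftPhases, this]

/-- The predicate `p` serves twice: for positivity of the gaps and for their closeness to the
spacing. -/
theorem liftPhases_revEnum_gap {x : EuclideanSpace ℝ (Fin (m + 1))}
    {σ : Equiv.Perm (Fin (m + 1))} {p : ℝ → Prop}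
    (hgap : ∀ i : Fin m, p (x (σ i.succ) - x (σ i.castSucc)))
    (hlast : p (x (σ 0) - x (σ (Fin.last m)) + 2 * Real.pi)) {k : ℕ} (hk : k < m + 1) :
    p (liftPhases x (revEnum σ) k - liftPhases x (revEnum σ) (k + 1)) := by
  rcases Nat.lt_succ_iff_lt_or_eq.1 hk with hk' | rfl
  · rw [liftPhases_of_lt hk, liftPhases_of_lt (by omega)]
    rw [revEnum_of_lt σ hk, revEnum_of_lt σ (by omega)]
    convert hgap ⟨m - 1 - k, by omega⟩ using 5 <;>
    · simp only [Fin.succ_mk, Fin.castSucc_mk]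
      omega
  · rw [liftPhases_self (isEnum_revEnum σ), liftPhases_of_lt hk, liftPhases_of_lt (by omega),
      revEnum_of_lt σ hk, revEnum_of_lt σ (by omega), ← sub_add]
    simp only [Nat.sub_self, Nat.sub_zero]
    exact hlast

theorem exists_enum_of_perm {x : EuclideanSpace ℝ (Fin (m + 1))}
    {σ : Equiv.Perm (Fin (m + 1))}
    (hgap : ∀ i : Fin m, x (σ i.castSucc) < x (σ i.succ))
    (hlast : x (σ (Fin.last m)) < x (σ 0) + 2 * Real.pi) :
    IsCyclic (m + 1) (liftPhases x (revEnum σ)) ∧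
      ∀ k < m + 1, liftPhases x (revEnum σ) (k + 1) < liftPhases x (revEnum σ) k := by
  have hs : ∀ k < m + 1, liftPhases x (revEnum σ) (k + 1) < liftPhases x (revEnum σ) k :=
    fun k hk => sub_pos.1 <| liftPhases_revEnum_gap (p := fun g => 0 < g)
      (fun i => sub_pos.2 (hgap i)) (by linarith) hk
  exact ⟨⟨fun k hk => (hs k hk).le, liftPhases_self (isEnum_revEnum σ)⟩, hs⟩

/-- The configurations without coincidences can be ordered cyclically. -/
theorem exists_enum_of_notMem_coincidenceSet (hm : 0 < m) {x : EuclideanSpace ℝ (Fin (m + 1))}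
    (hx : x ∈ box (m + 1)) (hx' : x ∉ coincidenceSet (m + 1)) :
    ∃ e y, IsEnum (m + 1) e ∧ IsCyclic (m + 1) y ∧ (∀ k < m + 1, y (k + 1) < y k) ∧
      ∀ k < m + 1, x (e k) = y k := by
  have hpi := Real.pi_pos
  -- Phases `0` and `2π` coincide on the circle, so a difference of `2π` is excluded as well; this
  -- makes the closing gap positive.
  have hne : ∀ i j, i ≠ j → x i ≤ x j → x i < x j ∧ x j < x i + 2 * Real.pi := by
    intro i j hij hle
    have h1 : x j - x i ≤ 2 * Real.pi := by linarith [(hx i).1, (hx j).2]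
    have h2 : geodesicDist (x j) (x i) ≠ 0 := fun h => hx' ⟨hx, j, i, hij.symm, h⟩
    rw [geodesicDist_eq_min (sub_nonneg.2 hle) h1] at h2
    refine ⟨hle.lt_of_ne fun h => h2 ?_, lt_of_le_of_ne (by linarith) fun h => h2 ?_⟩
    · rw [min_eq_left (by linarith)]; linarith
    · rw [min_eq_right (by linarith)]; linarith
  set σ := Tuple.sort fun i => x i
  have hmono : Monotone ((fun i => x i) ∘ σ) := Tuple.monotone_sort _
  obtain ⟨h1, h2⟩ := exists_enum_of_perm (x := x) (σ := σ)
    (fun i => (hne _ _ (σ.injective.ne i.castSucc_lt_succ.ne)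
      (hmono i.castSucc_lt_succ.le)).1)
    (hne _ _ (σ.injective.ne (show (0 : Fin (m + 1)) < Fin.last m from hm).ne) (hmono (Fin.zero_le _))).2
  exact ⟨_, _, isEnum_revEnum σ, h1, h2, fun k hk => (liftPhases_of_lt hk).symm⟩

/-- The configurations close to a splay state can be ordered cyclically, with a small excess. -/
theorem exists_enum_of_near_splaySet (hm : 0 < m) {x a : EuclideanSpace ℝ (Fin (m + 1))} {η : ℝ}
    (ha : a ∈ splaySet (m + 1)) (hη : 2 * η < spacing m) (hxa : dist x a ≤ η) :
    ∃ e y, IsEnum (m + 1) e ∧ IsCyclic (m + 1) y ∧ (∀ k < m + 1, y (k + 1) < y k) ∧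
      (∀ k < m + 1, x (e k) = y k) ∧ excess (m + 1) (spacing m) y ≤ (m + 1 : ℕ) * (2 * η) := by
  obtain ⟨σ, s, hs, hσ⟩ := exists_perm_of_mem_splaySet hm ha
  have hmd := mul_spacing' (m := m)
  have hη0 : 0 ≤ η := dist_nonneg.trans hxa
  have hnear : ∀ i, |x (σ i) - (s + (i : ℕ) * spacing m)| ≤ η := by
    intro i
    rw [← hσ, ← Real.norm_eq_abs]
    exact ((PiLp.norm_apply_le (x - a) (σ i)).trans_eq (dist_eq_norm _ _).symm).trans hxa
  have hgap : ∀ i : Fin m, |x (σ i.succ) - x (σ i.castSucc) - spacing m| ≤ 2 * η := by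
    intro i
    have h1 := abs_le.1 (hnear i.succ)
    have h2 := abs_le.1 (hnear i.castSucc)
    simp only [Fin.val_castSucc, Fin.val_succ, Nat.cast_add, Nat.cast_one] at h1 h2
    exact abs_le.2 ⟨by linarith, by linarith⟩
  have hlast : |x (σ 0) - x (σ (Fin.last m)) + 2 * Real.pi - spacing m| ≤ 2 * η := by
    have h1 := abs_le.1 (hnear 0)
    have h2 := abs_le.1 (hnear (Fin.last m))
    simp only [Fin.val_last, Fin.val_zero, Nat.cast_zero] at h1 h2
    exact abs_le.2 ⟨by linarith, by linarith⟩
  -- Every gap is at least `spacing m - 2 * η`, which is positive.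
  obtain ⟨h1, h2⟩ := exists_enum_of_perm (x := x) (σ := σ)
    (fun i => by linarith [(abs_le.1 (hgap i)).1]) (by linarith [(abs_le.1 hlast).1])
  refine ⟨_, _, isEnum_revEnum σ, h1, h2, fun k hk => (liftPhases_of_lt hk).symm, ?_⟩
  refine (Finset.sum_le_card_nsmul _ _ (2 * η) fun k hk => max_le (by linarith) ?_).trans_eq ?_
  · exact (abs_le.1 (liftPhases_revEnum_gap (p := fun g => |g - spacing m| ≤ 2 * η) hgap hlast
      (Finset.mem_range.1 hk))).2
  · simp

end Enumeration

/-! ### The excess controls the distance to the splay set -/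

section Distance

variable {m : ℕ}

theorem dist_le_of_forall_abs_sub_le {n : ℕ} {x z : EuclideanSpace ℝ (Fin n)} {B : ℝ} (hB : 0 ≤ B)
    (h : ∀ i, |x i - z i| ≤ B) : dist x z ≤ n * B := by
  rw [EuclideanSpace.dist_eq]
  refine Real.sqrt_le_iff.2 ⟨by positivity, ?_⟩
  have h1 : ∑ i, dist (x i) (z i) ^ 2 ≤ n * B ^ 2 := by
    refine (Finset.sum_le_card_nsmul _ _ (B ^ 2) fun i _ => ?_).trans_eq (by simp)
    rw [Real.dist_eq]
    exact pow_le_pow_left₀ (abs_nonneg _) (h i) 2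
  refine h1.trans ?_
  rw [mul_pow]
  refine mul_le_mul_of_nonneg_right ?_ (by positivity)
  rcases Nat.eq_zero_or_pos n with rfl | hn
  · simp
  · have : (1 : ℝ) ≤ n := by exact_mod_cast hn
    nlinarith

theorem sub_le_excess {n : ℕ} {d : ℝ} {y : ℕ → ℝ} {a b : ℕ} (hab : a ≤ b) (hb : b ≤ n) :
    y a - y b - (b - a) * d ≤ excess n d y := by
  have h1 : y a - y b - (b - a) * d = ∑ k ∈ Finset.Ico a b, (y k - y (k + 1) - d) := by
    have := Finset.sum_Ico_sub (fun k => y k + k * d) hab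
    rw [← neg_inj, ← Finset.sum_neg_distrib]
    calc _ = y b + b * d - (y a + a * d) := by ring
      _ = _ := by
        rw [← this]
        refine Finset.sum_congr rfl fun k _ => ?_
        push_cast
        ring
  rw [h1, excess]
  refine (Finset.sum_le_sum fun k _ => le_max_right _ _).trans
    (Finset.sum_le_sum_of_subset_of_nonneg ?_ fun _ _ _ => le_max_left _ _)
  intro k hk
  simp only [Finset.mem_Ico, Finset.mem_range] at *
  omega

/-- The deviations gap - d sum to zero over the whole circle, so a lower bound on the block from `a`
to `b` follows from the upper bounds on the two complementary blocks; hence the factor 2. -/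
theorem abs_sub_le_excess {n : ℕ} {d : ℝ} {y : ℕ → ℝ} (hd : n * d = 2 * Real.pi)
    (hy : IsCyclic n y) {a b : ℕ} (hab : a ≤ b) (hb : b ≤ n) :
    |y a - y b - (b - a) * d| ≤ 2 * excess n d y := by
  have h1 := sub_le_excess (d := d) (y := y) hab hb
  have h2 := sub_le_excess (d := d) (y := y) (Nat.zero_le a) (hab.trans hb)
  have h3 := sub_le_excess (d := d) (y := y) hb le_rfl
  have h4 := hy.closed
  have h5 := excess_nonneg (n := n) (d := d) (y := y)
  push_cast at h2
  exact abs_le.2 ⟨by linarith, by linarith⟩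

/-- The excess of the ordered phases controls the distance to the splay states. -/
theorem infDist_splaySet_le (hm : 0 < m) {x : EuclideanSpace ℝ (Fin (m + 1))} {e : ℕ → Fin (m + 1)}
    {y : ℕ → ℝ} {c : ℝ} (hx : x ∈ box (m + 1)) (he : IsEnum (m + 1) e) (hy : IsCyclic (m + 1) y)
    (hxy : ∀ k < m + 1, x (e k) = y k + c) :
    Metric.infDist x (splaySet (m + 1)) ≤
      (m + 1 : ℕ) * (3 * excess (m + 1) (spacing m) y) := by
  set V := excess (m + 1) (spacing m) y
  have hV : 0 ≤ V := excess_nonneg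
  have hd := spacing_pos (m := m)
  set f : Fin (m + 1) → Fin (m + 1) := fun k => e (Fin.rev k : Fin (m + 1)) with hf
  have hfs : Function.Surjective f := by
    intro i
    obtain ⟨k, hk, rfl⟩ := he.surj i
    refine ⟨Fin.rev ⟨k, hk⟩, ?_⟩
    simp only [hf, Fin.rev_rev]
  set σ := Equiv.ofBijective f (Finite.surjective_iff_bijective.1 hfs) with hσ
  -- The lowest phase of a splay state cannot exceed the spacing. The truncation costs at most `V`:
  -- as `x (e 0) ≤ 2π`, the closing gap is at least `x (e m)`.
  set s := min (x (e m)) (spacing m) with hs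
  have hs1 : |x (e m) - s| ≤ V := by
    have h1 := sub_le_excess (d := spacing m) (y := y) (Nat.le_succ m) le_rfl
    have h2 := (hx (e 0)).2
    rw [hxy 0 (by omega)] at h2
    have h3 := hy.closed
    have h4 := hxy m (by omega)
    push_cast at h1
    rw [abs_le]
    constructor
    · linarith [min_le_left (x (e m)) (spacing m)]
    · rcases min_cases (x (e m)) (spacing m) with ⟨h, _⟩ | ⟨h, _⟩ <;> rw [hs, h] <;> linarith
  set z : EuclideanSpace ℝ (Fin (m + 1)) :=
    WithLp.toLp 2 fun i => s + (σ.symm i : ℕ) * spacing m with hz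
  have hsI : s ∈ Icc 0 (spacing m) := ⟨le_min (hx _).1 hd.le, min_le_right _ _⟩
  have hzA : z ∈ splaySet (m + 1) :=
    mem_splaySet_of_perm hm σ hsI fun k => by simp [hz]
  refine (Metric.infDist_le_dist_of_mem hzA).trans
    (dist_le_of_forall_abs_sub_le (by positivity) fun i => ?_)
  obtain ⟨k, rfl⟩ := σ.surjective i
  have hk : z (σ k) = s + (k : ℕ) * spacing m := by simp [hz]
  have hxk : x (σ k) = y (m - k) + c := by
    have : σ k = e (m - k) := by
      simp [hσ, hf, Fin.val_rev]
    rw [this, hxy _ (by omega)]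
  rw [hk, hxk]
  -- The factor 3 is made of `2 * V` for the position relative to the lowest phase and `V` for
  -- replacing that phase by `s`.
  have h1 := abs_le.1 (abs_sub_le_excess mul_spacing hy (Nat.sub_le m k) (Nat.le_succ m))
  rw [Nat.cast_sub (Nat.le_of_lt_succ k.isLt)] at h1
  have h2 := abs_le.1 hs1
  rw [hxy m (by omega)] at h2
  exact abs_le.2 ⟨by linarith [h1.1, h2.1], by linarith [h1.2, h2.2]⟩

end Distance

/-! ### Coincidences have measure zero -/

section Null

theorem volume_setOf_sub_eq {n : ℕ} {i j : Fin n} (hij : i ≠ j) (c : ℝ) :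
    volume {x : EuclideanSpace ℝ (Fin n) | x i - x j = c} = 0 := by
  let f : EuclideanSpace ℝ (Fin n) →ₗ[ℝ] ℝ :=
    ((EuclideanSpace.proj i : EuclideanSpace ℝ (Fin n) →L[ℝ] ℝ) -
      (EuclideanSpace.proj j : EuclideanSpace ℝ (Fin n) →L[ℝ] ℝ) :
        EuclideanSpace ℝ (Fin n) →L[ℝ] ℝ)
  have hf : ∀ x, f x = x i - x j := fun x => rfl
  let S : AffineSubspace ℝ (EuclideanSpace ℝ (Fin n)) :=
    AffineSubspace.mk' (c • EuclideanSpace.single i (1 : ℝ)) (LinearMap.ker f)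
  have hS : ∀ x, x ∈ S ↔ x i - x j = c := by
    intro x
    simp only [S, AffineSubspace.mem_mk', vsub_eq_sub, LinearMap.mem_ker, hf]
    simp [hij.symm, sub_eq_iff_eq_add, add_comm]
  have hne : S ≠ ⊤ := by
    intro h
    have h1 := (hS ((c + 1) • EuclideanSpace.single i (1 : ℝ))).1 (h ▸ AffineSubspace.mem_top _ _ _)
    simp [hij.symm] at h1
  have := Measure.addHaar_affineSubspace volume S hne
  rwa [show (S : Set (EuclideanSpace ℝ (Fin n))) = {x | x i - x j = c} from Set.ext hS] at this

theorem volume_coincidenceSet (n : ℕ) : volume (coincidenceSet n) = 0 := by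
  have hsub : coincidenceSet n ⊆ ⋃ i : Fin n, ⋃ j : Fin n, ⋃ (_ : i ≠ j),
      ({x | x i - x j = 0} ∪ {x | x i - x j = 2 * Real.pi}) := by
    rintro x ⟨hx, i, j, hij, h⟩
    wlog hle : x j ≤ x i generalizing i j
    · exact this j i hij.symm (by rwa [geodesicDist_comm]) (le_of_not_ge hle)
    simp only [mem_iUnion]
    refine ⟨i, j, hij, ?_⟩
    rw [geodesicDist_eq_min (sub_nonneg.2 hle) (by linarith [(hx i).2, (hx j).1])] at h
    rcases min_choice (x i - x j) (2 * Real.pi - (x i - x j)) with h1 | h1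
    · exact Or.inl (h1.symm.trans h)
    · exact Or.inr (by have := h1.symm.trans h; simp only [mem_ofPred_eq]; linarith)
  refine measure_mono_null hsub ?_
  simp only [measure_iUnion_null_iff]
  exact fun i j hij => measure_union_null (volume_setOf_sub_eq hij _) (volume_setOf_sub_eq hij _)

end Null

end PCO
namespace PCO

/-! ### Structure of hybrid time domains -/

namespace HybridArc

variable {n : ℕ} {φ : HybridArc n}

theorem exists_jumpTimes {T : ℝ} {J : ℕ} (hp : (T, J) ∈ φ.dom) :
    ∃ τ : ℕ → ℝ, τ 0 = 0 ∧ Monotone τ ∧ τ (J + 1) = T ∧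
      ∀ t i, i ≤ J → ((t, i) ∈ φ.dom ∧ t ≤ T ↔ τ i ≤ t ∧ t ≤ τ (i + 1)) := by
  obtain ⟨K, τ, -, h0, hmono, hE⟩ := φ.isHybridTimeDomain.2.2 _ hp
  have hmem : ∀ t i, ((t, i) ∈ φ.dom ∧ t ≤ T ∧ i ≤ J) ↔ (i < K ∧ τ i ≤ t ∧ t ≤ τ (i + 1)) :=
    fun t i => Set.ext_iff.1 hE (t, i)
  have h1 := (hmem T J).1 ⟨hp, le_rfl, le_rfl⟩
  -- A larger `K` would put a point with index `J + 1` into the truncation at index `J`.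
  have hK : K = J + 1 := by
    by_contra hne
    have := ((hmem (τ (J + 1)) (J + 1)).2 ⟨by omega, le_rfl, hmono (Nat.le_succ _)⟩).2.2
    omega
  subst hK
  refine ⟨τ, h0, hmono, le_antisymm
    ((hmem (τ (J + 1)) J).2 ⟨by omega, hmono (Nat.le_succ _), le_rfl⟩).2.1 h1.2.2,
    fun t i hi => ?_⟩
  have := hmem t i
  constructor
  · rintro ⟨h2, h3⟩
    exact (this.1 ⟨h2, h3, hi⟩).2
  · intro h2
    have h3 := this.2 ⟨by omega, h2⟩
    exact ⟨h3.1, h3.2.1⟩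

theorem zero_mem_dom (φ : HybridArc n) : ((0 : ℝ), 0) ∈ φ.dom := by
  obtain ⟨⟨T, J⟩, hp⟩ := φ.isHybridTimeDomain.1
  obtain ⟨τ, h0, hmono, -, h⟩ := exists_jumpTimes hp
  exact ((h 0 0 (Nat.zero_le _)).2 ⟨h0.le, h0 ▸ hmono (Nat.zero_le _)⟩).1

theorem Icc_subset_timeSlice {s t : ℝ} {j : ℕ} (hs : (s, j) ∈ φ.dom) (ht : (t, j) ∈ φ.dom) :
    Icc s t ⊆ timeSlice φ.dom j := by
  intro u hu
  obtain ⟨τ, -, -, hT, h⟩ := exists_jumpTimes ht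
  have h1 := (h s j le_rfl).1 ⟨hs, hu.1.trans hu.2⟩
  exact ((h u j le_rfl).2 ⟨h1.1.trans hu.1, hu.2.trans hT.ge⟩).1

theorem exists_jump {t : ℝ} {j : ℕ} (ht : (t, j + 1) ∈ φ.dom) :
    ∃ s ≤ t, (s, j) ∈ φ.dom ∧ (s, j + 1) ∈ φ.dom := by
  obtain ⟨τ, -, hmono, hT, h⟩ := exists_jumpTimes ht
  have hle : τ (j + 1) ≤ t := hT ▸ hmono (Nat.le_succ _)
  exact ⟨τ (j + 1), hle, ((h _ j (Nat.le_succ _)).2 ⟨hmono (Nat.le_succ _), le_rfl⟩).1,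
    ((h _ (j + 1) le_rfl).2 ⟨le_rfl, hmono (Nat.le_succ _)⟩).1⟩

end HybridArc

/-! ### Explicit flow, invariance of the box, bounds on time -/

section Solutions

variable {n : ℕ} {ω : ℝ} {Q : ℝ → ℝ} {φ : HybridArc n}

theorem isClosed_box : IsClosed (box n) := by
  have : box n = ⋂ i, {x : EuclideanSpace ℝ (Fin n) | x i ∈ Icc 0 (2 * Real.pi)} := by
    ext x; simp [box]
  rw [this]
  exact isClosed_iInter fun i => isClosed_Icc.preimage (by fun_prop)

theorem isBounded_box : Bornology.IsBounded (box n) := by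
  refine (Metric.isBounded_iff_subset_closedBall 0).2 ⟨n * (2 * Real.pi), fun x hx => ?_⟩
  refine dist_le_of_forall_abs_sub_le (by positivity) fun i => ?_
  simpa [abs_of_nonneg (hx i).1] using (hx i).2

theorem mem_box_of_reset (hQ : ∀ z ∈ Icc 0 (2 * Real.pi), z + Q z ∈ Icc 0 (2 * Real.pi))
    {x y : EuclideanSpace ℝ (Fin n)} (hx : x ∈ box n) (hy : y ∈ (network n ω Q).G x) :
    y ∈ box n := by
  have h0 : (0 : ℝ) ∈ Icc 0 (2 * Real.pi) := ⟨le_rfl, by positivity⟩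
  intro i
  rcases hy i with ⟨-, -, h⟩ | ⟨-, -, h⟩ | ⟨-, -, h | h⟩
  · exact h ▸ h0
  · exact h ▸ hQ _ (hx i)
  · exact h ▸ h0
  · exact h ▸ hQ _ (hx i)

/-- Subtracting `u • v` leaves an absolutely continuous function with derivative zero almost
everywhere, hence a constant. -/
theorem HybridSystem.IsSolution.flow (hφ : (network n ω Q).IsSolution φ) {s t : ℝ} {j : ℕ}
    (hs : (s, j) ∈ φ.dom) (ht : (t, j) ∈ φ.dom) :
    φ.val t j = φ.val s j + (t - s) • WithLp.toLp 2 fun _ => ω := by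
  wlog hst : s ≤ t generalizing s t
  · rw [this ht hs (le_of_not_ge hst)]
    module
  set v : EuclideanSpace ℝ (Fin n) := WithLp.toLp 2 fun _ => ω with hv
  have hsub := HybridArc.Icc_subset_timeSlice hs ht
  have hac : AbsolutelyContinuousOnInterval (fun u => φ.val u j - u • v) s t := by
    refine (φ.absolutelyContinuous j s t hst hsub).sub (f := fun u => φ.val u j) ?_
    have : ContDiff ℝ 1 fun u : ℝ => u • v := by fun_prop
    exact ContDiffOn.absolutelyContinuousOnInterval this.contDiffOn
  have hae : ∀ᵐ u : ℝ, u ∈ uIcc s t → HasDerivAt (fun u => φ.val u j - u • v) 0 u := by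
    have h1 : ∀ᵐ u : ℝ, u ≠ s := by simp [ae_iff, measure_singleton]
    have h2 : ∀ᵐ u : ℝ, u ≠ t := by simp [ae_iff, measure_singleton]
    filter_upwards [(hφ.2.1 j).2, h1, h2] with u hu hus hut hmem
    rw [uIcc_of_le hst] at hmem
    have hint : u ∈ interior (timeSlice φ.dom j) :=
      interior_maximal (Ioo_subset_Icc_self.trans hsub) isOpen_Ioo
        ⟨lt_of_le_of_ne hmem.1 hus.symm, lt_of_le_of_ne hmem.2 hut⟩
    have h3 := (hu hint).sub ((hasDerivAt_id u).smul_const v)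
    have h4 : (network n ω Q).f (φ.val u j) - (1 : ℝ) • v = 0 := by simp [network, hv]
    rw [h4] at h3
    exact h3
  obtain ⟨c, hc⟩ := hac.const_of_ae_hasDerivAt_zero hae
  have h2 := hc t right_mem_uIcc
  rw [← hc s left_mem_uIcc, sub_eq_iff_eq_add] at h2
  rw [h2]
  module

theorem HybridSystem.IsSolution.flow_apply (hφ : (network n ω Q).IsSolution φ) {s t : ℝ} {j : ℕ}
    (hs : (s, j) ∈ φ.dom) (ht : (t, j) ∈ φ.dom) (i : Fin n) :
    φ.val t j i = φ.val s j i + (t - s) * ω := by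
  rw [hφ.flow hs ht]; simp

/-- Solutions are required to lie in `C` only on the interior of the time interval; the right
endpoint is reached because the box is closed. -/
theorem HybridSystem.IsSolution.flow_mem_box (hφ : (network n ω Q).IsSolution φ) {s t : ℝ} {j : ℕ}
    (hst : s ≤ t) (hs : (s, j) ∈ φ.dom) (ht : (t, j) ∈ φ.dom) (hb : φ.val s j ∈ box n) :
    φ.val t j ∈ box n := by
  rcases hst.eq_or_lt with rfl | hst
  · exact hb
  have hsub := HybridArc.Icc_subset_timeSlice hs ht
  have hcl : t ∈ closure (Ioo s t) := by
    rw [closure_Ioo hst.ne]; exact right_mem_Icc.2 hst.le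
  have hcont : Continuous fun u : ℝ =>
      φ.val s j + (u - s) • (WithLp.toLp 2 fun _ => ω : EuclideanSpace ℝ (Fin n)) := by fun_prop
  rw [← isClosed_box.closure_eq, hφ.flow hs ht]
  refine map_mem_closure (f := fun u : ℝ => φ.val s j + (u - s) • _) hcont hcl fun u hu => ?_
  change φ.val s j + (u - s) • _ ∈ _
  rw [← hφ.flow hs (hsub (Ioo_subset_Icc_self hu))]
  exact (hφ.2.1 j).1 u (interior_maximal (Ioo_subset_Icc_self.trans hsub) isOpen_Ioo hu)

theorem HybridSystem.IsSolution.zero_mem_box (hφ : (network n ω Q).IsSolution φ) : φ.val 0 0 ∈ box n := by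
  rcases hφ.1 with h | h
  · exact isClosed_box.closure_eq ▸ h
  · exact h.1

theorem HybridSystem.IsSolution.mem_box (hφ : (network n ω Q).IsSolution φ)
    (hQ : ∀ z ∈ Icc 0 (2 * Real.pi), z + Q z ∈ Icc 0 (2 * Real.pi)) {t : ℝ} {j : ℕ}
    (ht : (t, j) ∈ φ.dom) : φ.val t j ∈ box n := by
  induction j generalizing t with
  | zero => exact hφ.flow_mem_box (φ.isHybridTimeDomain.2.1 _ ht) φ.zero_mem_dom ht hφ.zero_mem_box
  | succ j ih =>
    obtain ⟨s, hst, hs, hs'⟩ := HybridArc.exists_jump ht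
    exact hφ.flow_mem_box hst hs' ht (mem_box_of_reset hQ (ih hs) (hφ.2.2 s j hs hs').2)

/-- In the jump set some oscillator has phase `2π`, so that no further flow is possible. -/
theorem HybridSystem.IsSolution.le_of_mem_jumpSet (hφ : (network n ω Q).IsSolution φ) (hω : 0 < ω)
    (hQ : ∀ z ∈ Icc 0 (2 * Real.pi), z + Q z ∈ Icc 0 (2 * Real.pi)) {s t : ℝ} {j : ℕ}
    (hs : (s, j) ∈ φ.dom) (hD : φ.val s j ∈ (network n ω Q).D) (ht : (t, j) ∈ φ.dom) : t ≤ s := by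
  obtain ⟨i, hi⟩ := hD.2.1
  have h1 := (hφ.mem_box hQ ht i).2
  simp only at hi
  rw [hφ.flow_apply hs ht, hi] at h1
  by_contra! hlt
  nlinarith

theorem HybridSystem.IsSolution.le_of_index_lt (hφ : (network n ω Q).IsSolution φ) (hω : 0 < ω)
    (hQ : ∀ z ∈ Icc 0 (2 * Real.pi), z + Q z ∈ Icc 0 (2 * Real.pi)) {s t : ℝ} {i j : ℕ}
    (hs : (s, i) ∈ φ.dom) (ht : (t, j) ∈ φ.dom) (hij : i < j) : s ≤ t := by
  induction j generalizing t with
  | zero => omega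
  | succ j ih =>
    obtain ⟨u, hut, hu, hu'⟩ := HybridArc.exists_jump ht
    refine le_trans ?_ hut
    rcases Nat.lt_succ_iff_lt_or_eq.1 hij with h | rfl
    · exact ih hu h
    · exact hφ.le_of_mem_jumpSet hω hQ hu (hφ.2.2 u i hu hu').1 hs

/-- Each flow interval lasts at most 2π/ω, so t + j → ∞ forces j → ∞. -/
theorem HybridSystem.IsSolution.time_le [NeZero n] (hφ : (network n ω Q).IsSolution φ)
    (hQ : ∀ z ∈ Icc 0 (2 * Real.pi), z + Q z ∈ Icc 0 (2 * Real.pi)) {t : ℝ} {j : ℕ}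
    (ht : (t, j) ∈ φ.dom) : t * ω ≤ 2 * Real.pi * (j + 1) := by
  have key : ∀ {s t : ℝ} {j : ℕ}, (s, j) ∈ φ.dom → (t, j) ∈ φ.dom →
      (t - s) * ω ≤ 2 * Real.pi := by
    intro s t j hs ht
    have := hφ.flow_apply hs ht 0
    linarith [(hφ.mem_box hQ ht 0).2, (hφ.mem_box hQ hs 0).1]
  induction j generalizing t with
  | zero => simpa using key φ.zero_mem_dom ht
  | succ j ih =>
    obtain ⟨s, -, hs, hs'⟩ := HybridArc.exists_jump ht
    have h1 := ih hs
    have h2 := key hs' ht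
    push_cast
    linarith

end Solutions

/-! ### Solutions follow the return map -/

section Tracking

variable {m : ℕ} {ω : ℝ} {Q : ℝ → ℝ} {φ : HybridArc (m + 1)} {h : ℝ → ℝ} {d : ℝ}

/-- In a configuration without coincidences the jump is given by the return map. -/
theorem reset_eq_returnMap (H : IsPhaseMap d h) (hd : d ≤ 2 * Real.pi)
    (hh : ∀ z ∈ Icc 0 (2 * Real.pi), h z = z + Q z)
    {x x' : EuclideanSpace ℝ (Fin (m + 1))} {e : ℕ → Fin (m + 1)} {y : ℕ → ℝ} {c : ℝ}
    (he : IsEnum (m + 1) e) (hy : IsCyclic (m + 1) y) (hs : ∀ k < m + 1, y (k + 1) < y k)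
    (hxy : ∀ k < m + 1, x (e k) = y k + c) (hD : x ∈ (network (m + 1) ω Q).D)
    (hG : x' ∈ (network (m + 1) ω Q).G x) :
    ∀ k < m + 1, x' (e (k + 1)) = returnMap (m + 1) h y k := by
  -- Some oscillator is at `2π` and `e 0` has the largest phase, so the leader is the one that
  -- fires.
  have hc : c = 2 * Real.pi - y 0 := by
    obtain ⟨i, hi⟩ := hD.2.1
    obtain ⟨k, hk, rfl⟩ := he.surj i
    simp only at hi
    have h1 := (hD.1 (e 0)).2
    rw [hxy 0 (by omega)] at h1
    rw [hxy k hk] at hi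
    linarith [hy.antitone (Nat.zero_le k) hk.le]
  have hfront : x (e 0) = 2 * Real.pi := by rw [hxy 0 (by omega), hc]; ring
  -- Strict ordering rules out simultaneous firing, so the set-valued reset is single-valued here.
  have hlt : ∀ k, 0 < k → k < m + 1 → x (e k) ≠ 2 * Real.pi := by
    intro k h0 hk
    rw [hxy k hk, hc]
    linarith [hs 0 (by omega), hy.antitone h0 hk.le]
  intro k hk
  rcases Nat.lt_succ_iff_lt_or_eq.1 hk with hk' | rfl
  · rw [returnMap_of_lt hk, ← hc, ← hxy (k + 1) (by omega), hh _ (hD.1 _)]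
    have hne := hlt (k + 1) (by omega) (by omega)
    rcases hG (e (k + 1)) with ⟨h1, -⟩ | ⟨-, -, h1⟩ | ⟨h1, -⟩
    · exact absurd h1 hne
    · exact h1
    · exact absurd h1 hne
  · have h0 := he.periodic 0
    rw [zero_add] at h0
    rw [returnMap_last H hd hy, h0]
    rcases hG (e 0) with ⟨-, -, h1⟩ | ⟨h1, -⟩ | ⟨-, ⟨j, hj, h1⟩, -⟩
    · exact h1
    · exact absurd hfront h1
    · obtain ⟨i, hi, rfl⟩ := he.surj j
      exact absurd h1 (hlt i (Nat.pos_of_ne_zero fun h => hj (by rw [h])) hi)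

/-- Along a solution, the ordered phases are the iterates of the return map, up to a shift. -/
theorem HybridSystem.IsSolution.exists_eq_iterate (hφ : (network (m + 1) ω Q).IsSolution φ)
    (H : IsPhaseMap d h) (hd : d ≤ 2 * Real.pi) (hh : ∀ z ∈ Icc 0 (2 * Real.pi), h z = z + Q z)
    {e : ℕ → Fin (m + 1)} {y : ℕ → ℝ}
    (he : IsEnum (m + 1) e) (hy : IsCyclic (m + 1) y) (hs : ∀ k < m + 1, y (k + 1) < y k)
    (hxy : ∀ k < m + 1, φ.val 0 0 (e k) = y k) {t : ℝ} {j : ℕ} (ht : (t, j) ∈ φ.dom) :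
    ∃ c, ∀ k < m + 1, φ.val t j (e (k + j)) = (returnMap (m + 1) h)^[j] y k + c := by
  induction j generalizing t with
  | zero =>
    refine ⟨(t - 0) * ω, fun k hk => ?_⟩
    rw [hφ.flow_apply φ.zero_mem_dom ht, Function.iterate_zero_apply, add_zero, hxy k hk]
  | succ j ih =>
    obtain ⟨s, -, hs1, hs2⟩ := HybridArc.exists_jump ht
    obtain ⟨c, hc⟩ := ih hs1
    obtain ⟨hD, hG⟩ := hφ.2.2 s j hs1 hs2
    have := reset_eq_returnMap H hd hh (he.add j) (isCyclic_iterate H hd hy j)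
      (iterate_strict H hd hy hs j) hc hD hG
    refine ⟨(t - s) * ω, fun k hk => ?_⟩
    rw [hφ.flow_apply hs2 ht, Function.iterate_succ_apply', ← this k hk]
    simp only [add_assoc, add_comm 1 j]

end Tracking

end PCO
namespace PCO

/-! ### Extension of solutions and completeness -/

theorem isHybridTimeDomain_of_jumpTimes {E : Set (ℝ × ℕ)} {K : ℕ} {τ : ℕ → ℝ} (h0 : τ 0 = 0)
    (hmono : Monotone τ) (hE : ∀ t i, (t, i) ∈ E ↔ i ≤ K ∧ τ i ≤ t ∧ t ≤ τ (i + 1)) :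
    IsHybridTimeDomain E := by
  refine ⟨⟨(τ 0, 0), (hE _ _).2 ⟨Nat.zero_le _, le_rfl, hmono (Nat.zero_le _)⟩⟩, ?_, ?_⟩
  · rintro ⟨t, i⟩ hp
    exact h0.symm.le.trans ((hmono (Nat.zero_le i)).trans ((hE t i).1 hp).2.1)
  · rintro ⟨t, i⟩ hp
    obtain ⟨hiK, hit, hti⟩ := (hE t i).1 hp
    refine ⟨i + 1, fun j => if j ≤ i then τ j else t, Nat.succ_pos _, by simpa using h0, ?_, ?_⟩
    · refine monotone_nat_of_le_succ fun j => ?_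
      split_ifs with h1 h2
      · exact hmono (Nat.le_succ j)
      · exact (hmono h1).trans hit
      · omega
      · exact le_rfl
    · ext ⟨s, j⟩
      simp only [mem_ofPred_eq, hE]
      rcases lt_trichotomy j i with hj | rfl | hj
      · rw [if_pos hj.le, if_pos (Nat.succ_le_of_lt hj)]
        constructor
        · rintro ⟨⟨-, h1, h2⟩, -, -⟩
          exact ⟨by omega, h1, h2⟩
        · rintro ⟨-, h1, h2⟩
          exact ⟨⟨by omega, h1, h2⟩, h2.trans ((hmono hj).trans hit), hj.le⟩
      · rw [if_pos le_rfl, if_neg (by omega)]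
        constructor
        · rintro ⟨⟨-, h1, h2⟩, h3, -⟩
          exact ⟨by omega, h1, h3⟩
        · rintro ⟨-, h1, h2⟩
          exact ⟨⟨hiK, h1, h2.trans hti⟩, h2, le_rfl⟩
      · constructor
        · rintro ⟨-, -, h⟩; omega
        · rintro ⟨h, -⟩; omega

section Extension

variable {n : ℕ} {ω : ℝ} {Q : ℝ → ℝ} {φ : HybridArc n}

theorem reset_nonempty {x : EuclideanSpace ℝ (Fin n)} (hx : x ∈ (network n ω Q).D) :
    ((network n ω Q).G x).Nonempty := by
  classical
  obtain ⟨i₀, hi₀⟩ := hx.2.1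
  simp only at hi₀
  refine ⟨WithLp.toLp 2 fun i => if x i = 2 * Real.pi then 0 else x i + Q (x i), fun i => ?_⟩
  by_cases hi : x i = 2 * Real.pi
  · by_cases hj : ∃ j, j ≠ i ∧ x j = 2 * Real.pi
    · exact Or.inr (Or.inr ⟨hi, hj, Or.inl (if_pos hi)⟩)
    · push Not at hj
      exact Or.inl ⟨hi, hj, if_pos hi⟩
  · exact Or.inr (Or.inl ⟨hi, ⟨i₀, fun h => hi (h ▸ hi₀), hi₀⟩, if_neg hi⟩)

/-- A solution with a last jump index `K` can be continued: first flow until some oscillator has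
phase `2π`, then jump. -/
theorem HybridSystem.IsSolution.exists_extension [NeZero n]
    (hφ : (network n ω Q).IsSolution φ) (hω : 0 < ω)
    (hQ : ∀ z ∈ Icc 0 (2 * Real.pi), z + Q z ∈ Icc 0 (2 * Real.pi)) {b : ℝ} {K : ℕ}
    (hb : (b, K) ∈ φ.dom) (htop : ∀ t i, (t, i) ∈ φ.dom → i ≤ K) :
    ∃ ψ : HybridArc n, (network n ω Q).IsSolution ψ ∧ φ.IsProperTruncation ψ := by
  obtain ⟨τ, hτ0, hτm, hτb, hτ⟩ := HybridArc.exists_jumpTimes hb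
  set a := τ K with ha
  have hab : a ≤ b := hτb ▸ hτm (Nat.le_succ K)
  have haK : (a, K) ∈ φ.dom := ((hτ a K le_rfl).2 ⟨le_rfl, hab.trans hτb.ge⟩).1
  have hlow : ∀ t i, i < K → ((t, i) ∈ φ.dom ↔ τ i ≤ t ∧ t ≤ τ (i + 1)) := fun t i hi =>
    ⟨fun h => (hτ t i hi.le).1 ⟨h, hφ.le_of_index_lt hω hQ h hb hi⟩,
      fun h => ((hτ t i hi.le).2 h).1⟩
  have hale : ∀ t, (t, K) ∈ φ.dom → a ≤ t := by
    intro t ht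
    rcases le_total t b with h | h
    · exact ((hτ t K le_rfl).1 ⟨ht, h⟩).1
    · exact hab.trans h
  set v : EuclideanSpace ℝ (Fin n) := WithLp.toLp 2 fun _ => ω with hv
  set x := φ.val a K with hx
  have hxb : x ∈ box n := hφ.mem_box hQ haK
  obtain ⟨i₀, hi₀⟩ := Finite.exists_max fun i => x i
  -- The time at which the leading oscillator `i₀` reaches `2π`.
  set T := a + (2 * Real.pi - x i₀) / ω with hT
  have hTω : (T - a) * ω = 2 * Real.pi - x i₀ := by
    rw [hT]; field_simp; ring
  have haT : a ≤ T := by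
    have : 0 ≤ (2 * Real.pi - x i₀) / ω := div_nonneg (by linarith [(hxb i₀).2]) hω.le
    linarith
  have hleT : ∀ t, (t, K) ∈ φ.dom → t ≤ T := by
    intro t ht
    have h1 := (hφ.mem_box hQ ht i₀).2
    rw [hφ.flow_apply haK ht] at h1
    by_contra! h
    nlinarith
  have hflow : ∀ t i, (x + (t - a) • v) i = x i + (t - a) * ω := fun t i => by simp [hv]
  have hbox : ∀ t, a ≤ t → t ≤ T → x + (t - a) • v ∈ box n := by
    intro t h1 h2 i
    rw [hflow]
    have h3 : (t - a) * ω ≤ (T - a) * ω := mul_le_mul_of_nonneg_right (by linarith) hω.le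
    have h4 : 0 ≤ (t - a) * ω := mul_nonneg (by linarith) hω.le
    exact ⟨by linarith [(hxb i).1], by linarith [hi₀ i]⟩
  have hD : x + (T - a) • v ∈ (network n ω Q).D := by
    refine ⟨hbox T haT le_rfl, ⟨i₀, ?_⟩, ?_⟩
    · simp only [hflow, hTω]; ring
    · rintro _ ⟨i, rfl⟩
      exact (hbox T haT le_rfl i).2
  obtain ⟨g, hg⟩ := reset_nonempty hD
  set σ : ℕ → ℝ := fun i => if i ≤ K then τ i else T with hσ
  -- Levels below `K` are kept, level `K` becomes `[a, T]`, and level `K + 1` is the single instant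
  -- `T`, where no flow condition applies.
  set E : Set (ℝ × ℕ) := {p | p.2 ≤ K + 1 ∧ σ p.2 ≤ p.1 ∧ p.1 ≤ σ (p.2 + 1)} with hE
  have hElow : ∀ t i, i < K → ((t, i) ∈ E ↔ (t, i) ∈ φ.dom) := by
    intro t i hi
    rw [hlow t i hi]
    simp only [hE, hσ, mem_ofPred_eq, if_pos hi.le, if_pos (Nat.succ_le_of_lt hi)]
    exact ⟨fun h => h.2, fun h => ⟨by omega, h⟩⟩
  have hEK : ∀ t, (t, K) ∈ E ↔ a ≤ t ∧ t ≤ T := by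
    intro t
    simp [hE, hσ, ha]
  have hEK1 : ∀ t, (t, K + 1) ∈ E ↔ t = T := by
    intro t
    simp [hE, hσ, le_antisymm_iff (a := t), and_comm (a := t ≤ T)]
  have hEtop : ∀ t i, (t, i) ∈ E → i < K ∨ i = K ∨ i = K + 1 := by
    intro t i h
    have : i ≤ K + 1 := h.1
    omega
  set val : ℝ → ℕ → EuclideanSpace ℝ (Fin n) := fun t j =>
    if j = K then x + (t - a) • v else if j = K + 1 then g else φ.val t j with hval
  have hvK : ∀ t, val t K = x + (t - a) • v := fun t => if_pos rfl
  have hvK1 : ∀ t, val t (K + 1) = g := fun t => by simp [hval]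
  have hvlow : ∀ t j, j < K → val t j = φ.val t j := fun t j hj => by
    simp only [hval, if_neg hj.ne, if_neg (hj.trans (Nat.lt_succ_self K)).ne]
  have hsub : φ.dom ⊆ E := by
    rintro ⟨t, i⟩ h
    rcases (htop t i h).lt_or_eq with hi | rfl
    · exact (hElow t i hi).2 h
    · exact (hEK t).2 ⟨hale t h, hleT t h⟩
  have hagree : ∀ t i, (t, i) ∈ φ.dom → φ.val t i = val t i := by
    intro t i h
    rcases (htop t i h).lt_or_eq with hi | rfl
    · exact (hvlow t i hi).symm
    · rw [hvK, hφ.flow haK h]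
  have hslice : ∀ i, i < K → timeSlice E i = timeSlice φ.dom i := fun i hi =>
    Set.ext fun t => hElow t i hi
  let ψ : HybridArc n :=
    { dom := E
      val := val
      isHybridTimeDomain := by
        refine isHybridTimeDomain_of_jumpTimes (K := K + 1) (τ := σ) ?_ ?_ fun t i => Iff.rfl
        · simp [hσ, hτ0]
        · refine monotone_nat_of_le_succ fun j => ?_
          simp only [hσ]
          split_ifs with h1 h2
          · exact hτm (Nat.le_succ j)
          · exact (hτm h1).trans haT
          · omega
          · exact le_rfl
      absolutelyContinuous := by
        intro j s t hst hsubj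
        rcases hEtop s j (hsubj (left_mem_Icc.2 hst)) with hj | rfl | rfl
        · simp only [hvlow _ j hj]
          exact φ.absolutelyContinuous j s t hst (hslice j hj ▸ hsubj)
        · simp only [hvK]
          have : ContDiff ℝ 1 fun u : ℝ => x + (u - a) • v := by fun_prop
          exact ContDiffOn.absolutelyContinuousOnInterval this.contDiffOn
        · simp only [hvK1]
          have : ContDiff ℝ 1 fun _ : ℝ => g := by fun_prop
          exact ContDiffOn.absolutelyContinuousOnInterval this.contDiffOn }
  refine ⟨ψ, ⟨?_, fun j => ?_, ?_⟩, ⟨hsub, fun h => ?_⟩, fun p hp => hagree p.1 p.2 hp⟩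
  · change val 0 0 ∈ _
    rw [← hagree 0 0 φ.zero_mem_dom]
    exact hφ.1
  · change (∀ t ∈ interior (timeSlice E j), val t j ∈ box n) ∧
      ∀ᵐ t : ℝ, t ∈ interior (timeSlice E j) → HasDerivAt (fun s => val s j) v t
    rcases lt_trichotomy j K with hj | rfl | hj
    · simp only [hvlow _ j hj, hslice j hj]
      exact hφ.2.1 j
    · simp only [hvK]
      refine ⟨fun t ht => ?_, Eventually.of_forall fun t _ => ?_⟩
      · have := (hEK t).1 (interior_subset (s := timeSlice E _) ht)
        exact hbox t this.1 this.2
      · simpa using (((hasDerivAt_id t).sub_const a).smul_const v).const_add x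
    · have hempty : interior (timeSlice E j) = ∅ := by
        refine subset_empty_iff.1 ((interior_mono (t := {T}) fun t ht => ?_).trans
          (interior_singleton T).subset)
        rcases hEtop t j ht with h | h | rfl
        · omega
        · omega
        · exact (hEK1 t).1 ht
      simp [hempty]
  · intro t j (h1 : (t, j) ∈ E) (h2 : (t, j + 1) ∈ E)
    change val t j ∈ (network n ω Q).D ∧ val t (j + 1) ∈ (network n ω Q).G (val t j)
    rcases hEtop t (j + 1) h2 with hj | hj | hj
    · have h3 := (hElow t _ hj).1 h2
      have h4 := (hElow t _ (by omega)).1 h1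
      rw [← hagree _ _ h3, ← hagree _ _ h4]
      exact hφ.2.2 t j h4 h3
    -- The jump into level `K` can only occur at `t = a`, the start of that level, so it is already
    -- a jump of `φ`.
    · have h4 := (hElow t j (by omega)).1 h1
      have h3 : t = a := by
        refine le_antisymm ?_ ((hEK t).1 (hj ▸ h2)).1
        rw [ha, ← hj]
        exact ((hlow t j (by omega)).1 h4).2
      have h5 : (t, j + 1) ∈ φ.dom := by rw [h3, hj]; exact haK
      rw [← hagree _ _ h5, ← hagree _ _ h4]
      exact hφ.2.2 t j h4 h5
    · obtain rfl : j = K := by omega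
      rw [(hEK1 t).1 h2, hvK, hvK1]
      exact ⟨hD, hg⟩
  · have := htop T (K + 1) (h ((hEK1 T).2 rfl))
    omega

theorem HybridSystem.IsMaximalSolution.exists_mem_dom [NeZero n] (hφ : (network n ω Q).IsMaximalSolution φ)
    (hω : 0 < ω) (hQ : ∀ z ∈ Icc 0 (2 * Real.pi), z + Q z ∈ Icc 0 (2 * Real.pi)) (J : ℕ) :
    ∃ t, (t, J) ∈ φ.dom := by
  induction J with
  | zero => exact ⟨0, φ.zero_mem_dom⟩
  | succ K ih =>
    by_contra! hno
    obtain ⟨b, hb⟩ := ih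
    have htop : ∀ t i, (t, i) ∈ φ.dom → i ≤ K := by
      intro t i ht
      induction i generalizing t with
      | zero => exact Nat.zero_le K
      | succ i ih =>
        obtain ⟨s, -, hs, -⟩ := HybridArc.exists_jump ht
        rcases (ih s hs).lt_or_eq with h | rfl
        · exact h
        · exact absurd ht (hno t)
    obtain ⟨ψ, hψ, hφψ⟩ := hφ.1.exists_extension hω hQ hb htop
    exact hφ.2 ψ hψ hφψ

theorem HybridSystem.IsMaximalSolution.isComplete [NeZero n] (hφ : (network n ω Q).IsMaximalSolution φ)
    (hω : 0 < ω) (hQ : ∀ z ∈ Icc 0 (2 * Real.pi), z + Q z ∈ Icc 0 (2 * Real.pi)) :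
    φ.IsComplete := by
  intro hbdd
  obtain ⟨R, hR⟩ := (Metric.isBounded_iff_subset_closedBall (0, 0)).1 hbdd
  obtain ⟨J, hJ⟩ := exists_nat_gt R
  obtain ⟨t, ht⟩ := hφ.exists_mem_dom hω hQ J
  have h1 : dist (t, J) ((0 : ℝ), 0) ≤ R := hR ht
  have h2 : dist J 0 ≤ R := (le_max_right _ _).trans h1
  rw [Nat.dist_eq] at h2
  simp at h2
  linarith

end Extension

end PCO
namespace PCO

/-! ### The phase map of Q, stability and attraction -/

/-- A continuous injective function on an interval is strictly monotone, and the values at `0` and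
`2π` show that it increases. Extending it by constants outside `[0, 2π]` makes it continuous on ℝ,
as needed for the continuity of the return map. -/
theorem exists_isPhaseMap {m : ℕ} (hm : 0 < m) {Q : ℝ → ℝ}
    (hQcont : ContinuousOn Q (Icc 0 (2 * Real.pi)))
    (hQinj : InjOn (fun z => z + Q z) (Icc 0 (2 * Real.pi)))
    (hQgph : (fun z => (z, Q z)) '' Icc 0 (2 * Real.pi) ⊆ Q₁ (m + 1) ∪ Q₂ (m + 1)) :
    ∃ h, IsPhaseMap (spacing m) h ∧ ∀ z ∈ Icc 0 (2 * Real.pi), h z = z + Q z := by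
  have hpi : (0 : ℝ) ≤ 2 * Real.pi := by positivity
  have hd := spacing_pos (m := m)
  have hd2 := spacing_le hm
  have hL : 2 * Real.pi * ((m + 1 : ℕ) - 1) / (m + 1 : ℕ) = 2 * Real.pi - spacing m := by
    unfold spacing
    field_simp
  have hQ1 : ∀ z, 0 ≤ z → z ≤ 2 * Real.pi - spacing m → Q z = 0 := by
    intro z h0 h1
    rcases hQgph ⟨z, ⟨h0, by linarith⟩, rfl⟩ with h | h
    · exact h.2
    · exact absurd h.1.1 (by rw [hL]; exact h1.not_gt)
  have hQ2 : ∀ z, 2 * Real.pi - spacing m < z → z ≤ 2 * Real.pi →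
      2 * Real.pi - spacing m < z + Q z ∧ z + Q z < z := by
    intro z h0 h1
    rcases hQgph ⟨z, ⟨by linarith, h1⟩, rfl⟩ with h | h
    · exact absurd h.1.2 (by rw [hL]; exact h0.not_ge)
    · have h2 := h.2.1
      have h3 := h.2.2
      rw [hL] at h2
      exact ⟨by linarith, by linarith⟩
  set f : ℝ → ℝ := fun z => z + Q z with hf
  have hfc : ContinuousOn f (Icc 0 (2 * Real.pi)) := continuousOn_id.add hQcont
  have hh : ∀ z ∈ Icc 0 (2 * Real.pi), IccExtend hpi ((Icc 0 (2 * Real.pi)).domRestrict f) z = f z :=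
    fun z hz => IccExtend_of_mem hpi _ hz
  refine ⟨IccExtend hpi ((Icc 0 (2 * Real.pi)).domRestrict f), ⟨?_, ?_, ?_, ?_, ?_⟩, hh⟩
  · exact (continuousOn_iff_continuous_domRestrict.1 hfc).Icc_extend'
  · have hmono : StrictMonoOn f (Icc 0 (2 * Real.pi)) := by
      refine hfc.strictMonoOn_of_injOn_Icc hpi ?_ hQinj
      have h1 := hQ1 0 le_rfl (by linarith)
      have h2 := (hQ2 (2 * Real.pi) (by linarith) le_rfl).1
      simp only [hf, h1]
      linarith
    intro a ha b hb hab
    rw [hh a ha, hh b hb]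
    exact hmono ha hb hab
  · intro w h0 h1
    rw [hh w ⟨h0, by linarith⟩, hf]
    simp only [hQ1 w h0 h1, add_zero]
  · intro w h0 h1
    rw [hh w ⟨by linarith, h1⟩]
    exact (hQ2 w h0 h1).1
  · intro w h0 h1
    rw [hh w ⟨by linarith, h1⟩]
    exact (hQ2 w h0 h1).2

section Attraction

variable {m : ℕ} {ω : ℝ} {Q : ℝ → ℝ} {φ : HybridArc (m + 1)} {h : ℝ → ℝ}

theorem IsPhaseMap.mapsTo (H : IsPhaseMap (spacing m) h) (hm : 0 < m)
    (hh : ∀ z ∈ Icc 0 (2 * Real.pi), h z = z + Q z) :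
    ∀ z ∈ Icc 0 (2 * Real.pi), z + Q z ∈ Icc 0 (2 * Real.pi) := by
  intro z hz
  rw [← hh z hz]
  have hd : spacing m ≤ 2 * Real.pi := by linarith [spacing_le hm, spacing_pos (m := m)]
  exact ⟨H.apply_nonneg hd hz.1 hz.2, (H.apply_le hz.1 hz.2).trans hz.2⟩

theorem HybridSystem.IsSolution.infDist_le_excess_iterate
    (hφ : (network (m + 1) ω Q).IsSolution φ) (hm : 0 < m) (H : IsPhaseMap (spacing m) h)
    (hh : ∀ z ∈ Icc 0 (2 * Real.pi), h z = z + Q z) {e : ℕ → Fin (m + 1)} {y : ℕ → ℝ}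
    (he : IsEnum (m + 1) e) (hy : IsCyclic (m + 1) y) (hs : ∀ k < m + 1, y (k + 1) < y k)
    (hxy : ∀ k < m + 1, φ.val 0 0 (e k) = y k) {t : ℝ} {j : ℕ} (ht : (t, j) ∈ φ.dom) :
    Metric.infDist (φ.val t j) (splaySet (m + 1)) ≤
      (m + 1 : ℕ) * (3 * excess (m + 1) (spacing m) ((returnMap (m + 1) h)^[j] y)) := by
  have hd : spacing m ≤ 2 * Real.pi := by linarith [spacing_le hm, spacing_pos (m := m)]
  obtain ⟨c, hc⟩ := hφ.exists_eq_iterate H hd hh he hy hs hxy ht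
  exact infDist_splaySet_le hm (hφ.mem_box (H.mapsTo hm hh) ht) (he.add j)
    (isCyclic_iterate H hd hy j) hc

theorem HybridSystem.IsSolution.convergesTo_splaySet
    (hφ : (network (m + 1) ω Q).IsSolution φ) (hm : 0 < m) (hω : 0 < ω)
    (H : IsPhaseMap (spacing m) h)
    (hh : ∀ z ∈ Icc 0 (2 * Real.pi), h z = z + Q z) {e : ℕ → Fin (m + 1)} {y : ℕ → ℝ}
    (he : IsEnum (m + 1) e) (hy : IsCyclic (m + 1) y) (hs : ∀ k < m + 1, y (k + 1) < y k)
    (hxy : ∀ k < m + 1, φ.val 0 0 (e k) = y k) : φ.ConvergesTo (splaySet (m + 1)) := by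
  have hd : spacing m ≤ 2 * Real.pi := by linarith [spacing_le hm, spacing_pos (m := m)]
  intro ε hε
  have hlim := ((tendsto_excess_iterate H mul_spacing hd hm hy).const_mul 3).const_mul
    ((m + 1 : ℕ) : ℝ)
  rw [mul_zero, mul_zero] at hlim
  obtain ⟨J, hJ⟩ := eventually_atTop.1 (hlim.eventually_lt_const hε)
  -- Before jump `J` the elapsed time is at most `2π J / ω`, so beyond this threshold `j ≥ J`.
  refine ⟨2 * Real.pi * J / ω + J, ?_⟩
  rintro ⟨t, j⟩ ht hT
  refine (hφ.infDist_le_excess_iterate hm H hh he hy hs hxy ht).trans_lt (hJ j ?_)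
  by_contra! hj
  have h1 := hφ.time_le (H.mapsTo hm hh) ht
  have h2 : (j : ℝ) + 1 ≤ J := by exact_mod_cast hj
  have h3 : t ≤ 2 * Real.pi * J / ω := by
    rw [le_div_iff₀ hω]
    exact h1.trans (mul_le_mul_of_nonneg_left h2 (by positivity))
  simp only at hT
  linarith

theorem HybridSystem.IsSolution.isBounded {n : ℕ} {φ : HybridArc n}
    (hφ : (network n ω Q).IsSolution φ)
    (hQ : ∀ z ∈ Icc 0 (2 * Real.pi), z + Q z ∈ Icc 0 (2 * Real.pi)) : φ.IsBounded := by
  refine isBounded_box.subset ?_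
  rintro _ ⟨p, hp, rfl⟩
  exact hφ.mem_box hQ hp

theorem box_diff_coincidenceSet_subset_basin (hm : 0 < m) (hω : 0 < ω)
    (H : IsPhaseMap (spacing m) h) (hh : ∀ z ∈ Icc 0 (2 * Real.pi), h z = z + Q z) :
    box (m + 1) \ coincidenceSet (m + 1) ⊆ (network (m + 1) ω Q).basin (splaySet (m + 1)) := by
  rintro _ ⟨hx, hx'⟩ φ hφ rfl
  obtain ⟨e, y, he, hy, hs, hxy⟩ := exists_enum_of_notMem_coincidenceSet hm hx hx'
  exact ⟨hφ.1.isBounded (H.mapsTo hm hh), hφ.isComplete hω (H.mapsTo hm hh),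
    hφ.1.convergesTo_splaySet hm hω H hh he hy hs hxy⟩

theorem volume_compl_basin (hm : 0 < m) (hω : 0 < ω)
    (H : IsPhaseMap (spacing m) h) (hh : ∀ z ∈ Icc 0 (2 * Real.pi), h z = z + Q z) :
    volume ((network (m + 1) ω Q).basin (splaySet (m + 1)))ᶜ = 0 := by
  refine measure_mono_null (fun x hx => ?_) (volume_coincidenceSet (m + 1))
  by_contra hx'
  refine hx ?_
  by_cases hxb : x ∈ box (m + 1)
  · exact box_diff_coincidenceSet_subset_basin hm hω H hh ⟨hxb, hx'⟩
  -- Outside the box no solution starts, so membership in the basin is vacuous.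
  · rintro φ hφ rfl
    exact absurd hφ.1.zero_mem_box hxb

theorem exists_mem_splaySet_dist_le (hm : 0 < m) {x : EuclideanSpace ℝ (Fin (m + 1))} {δ : ℝ}
    (hx : Metric.infDist x (splaySet (m + 1)) ≤ δ) :
    ∃ a ∈ splaySet (m + 1), dist x a ≤ δ := by
  obtain ⟨a, ha, h⟩ := (isCompact_splaySet hm).exists_infDist_eq_dist (splaySet_nonempty hm) x
  exact ⟨a, ha, h ▸ hx⟩

theorem isStable_splaySet (hm : 0 < m) (H : IsPhaseMap (spacing m) h)
    (hh : ∀ z ∈ Icc 0 (2 * Real.pi), h z = z + Q z) :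
    (network (m + 1) ω Q).IsStable (splaySet (m + 1)) := by
  have hd0 := spacing_pos (m := m)
  have hd : spacing m ≤ 2 * Real.pi := by linarith [spacing_le hm]
  intro ε hε
  set M : ℝ := ((m + 1 : ℕ) : ℝ) with hM
  have hMpos : 0 < M := by positivity
  -- The first bound keeps the gaps positive. In the second, the initial excess is at most `2 * M *
  -- δ` and the distance at most `3 * M` times the excess, whence `6 * M ^ 2`.
  refine ⟨min (spacing m / 4) (ε / (6 * M ^ 2)), by positivity, fun φ hφ hφ0 => ?_⟩
  rintro ⟨t, j⟩ ht
  obtain ⟨a, ha, hxa⟩ := exists_mem_splaySet_dist_le hm hφ0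
  obtain ⟨e, y, he, hy, hs, hxy, hV⟩ := exists_enum_of_near_splaySet hm ha
    (by linarith [min_le_left (spacing m / 4) (ε / (6 * M ^ 2))]) hxa
  refine (hφ.infDist_le_excess_iterate hm H hh he hy hs hxy ht).trans ?_
  have h1 := excess_iterate_antitone H hd hy (Nat.zero_le j)
  simp only [Function.iterate_zero_apply] at h1
  have h2 : min (spacing m / 4) (ε / (6 * M ^ 2)) ≤ ε / (6 * M ^ 2) := min_le_right _ _
  calc M * (3 * excess (m + 1) (spacing m) ((returnMap (m + 1) h)^[j] y))
      ≤ M * (3 * (M * (2 * (ε / (6 * M ^ 2))))) := by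
        refine mul_le_mul_of_nonneg_left ?_ hMpos.le
        have h3 : M * (2 * min (spacing m / 4) (ε / (6 * M ^ 2))) ≤
          M * (2 * (ε / (6 * M ^ 2))) := mul_le_mul_of_nonneg_left (by linarith) hMpos.le
        linarith
    _ = ε := by field_simp; norm_num

theorem isLocallyAttractive_splaySet (hm : 0 < m) (hω : 0 < ω) (H : IsPhaseMap (spacing m) h)
    (hh : ∀ z ∈ Icc 0 (2 * Real.pi), h z = z + Q z) :
    (network (m + 1) ω Q).IsLocallyAttractive (splaySet (m + 1)) := by
  have hd0 := spacing_pos (m := m)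
  refine ⟨fun φ hφ => hφ.isComplete hω (H.mapsTo hm hh), spacing m / 4, by positivity,
    fun φ hφ hφ0 => ?_⟩
  obtain ⟨a, ha, hxa⟩ := exists_mem_splaySet_dist_le hm hφ0
  obtain ⟨e, y, he, hy, hs, hxy, -⟩ := exists_enum_of_near_splaySet hm ha (by linarith) hxa
  exact hφ.1.convergesTo_splaySet hm hω H hh he hy hs hxy

end Attraction

end PCO

theorem theorem1 (n : ℕ) (hn : 2 ≤ n) (ω : ℝ) (hω : 0 < ω) (Q : ℝ → ℝ)
    (hQcont : ContinuousOn Q (Set.Icc 0 (2 * Real.pi)))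
    (hQne : Q (2 * Real.pi) ≠ 0)
    (hQinj : Set.InjOn (fun z => z + Q z) (Set.Icc 0 (2 * Real.pi)))
    (hQgph : (fun z => (z, Q z)) '' Set.Icc 0 (2 * Real.pi) ⊆ PCO.Q₁ n ∪ PCO.Q₂ n) :
    (PCO.network n ω Q).IsAGAS (PCO.splaySet n) ∧
      PCO.box n \ PCO.coincidenceSet n ⊆ (PCO.network n ω Q).basin (PCO.splaySet n) := by
  obtain ⟨m, rfl⟩ : ∃ m, n = m + 1 := ⟨n - 1, by omega⟩
  have hm : 0 < m := by omega
  obtain ⟨h, H, hh⟩ := PCO.exists_isPhaseMap hm hQcont hQinj hQgph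
  exact ⟨⟨PCO.isCompact_splaySet hm,
    ⟨PCO.isStable_splaySet hm H hh, PCO.isLocallyAttractive_splaySet hm hω H hh⟩,
    PCO.volume_compl_basin hm hω H hh⟩, PCO.box_diff_coincidenceSet_subset_basin hm hω H hh⟩
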